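/- Let $\overline{\mathcal H}^3=\{(y,s)\in\mathbb R^3\times\mathbb R: s^2=|y|^2-1\}$ carry the Lorentz invariant measure $\bar\mu$, $$\int g\,d\bar\mu=\int_{|y|>1}\Big(g\big(y,\sqrt{|y|^2-1}\big)+g\big(y,-\sqrt{|y|^2-1}\big)\Big)\frac{dy}{\sqrt{|y|^2-1}},$$ and let $\overline T f(x,t)=\int e^{i(x\cdot y+ts)}f(y,s)\,d\bar\mu(y,s)$ for $f\in L^2(\bar\mu)$ complex valued, understood as the reflected Fourier transform $\widehat{f\bar\mu}(-x,-t)$ of the tempered measure $f\bar\mu$. Put $$\overline{\mathbf H}_4=\sup_{0\ne f\in L^2(\bar\mu)}\frac{\|\overline Tf\|_{L^4(\mathbb R^4)}}{\|f\|_{L^2(\bar\mu)}}.$$ Let $\{f_n\}_n\subset L^2(\bar\mu)$ be an $L^2$-normalized extremizing sequence, that is, $\|f_n\|_{L^2(\bar\mu)}=1$ for all $n$ and $\|\overline Tf_n\|_{L^4(\mathbb R^4)}\to\overline{\mathbf H}_4$. A sequence $\{\rho_k\}_k\subset L^2(\bar\mu)$ with $\|\rho_k\|_{L^2(\bar\mu)}=1$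 is said to satisfy dichotomy if there is $\alpha\in(0,1)$ such that for every $\varepsilon>0$ there exist $R,k_0\in\mathbb N$, real sequences $\{\ell_k\}_k$ and $\{R_k\}_k$ with $R_k\to\infty$, and complex valued functions $\rho_{k,1},\rho_{k,2}\in L^2(\bar\mu)$ such that for all $k\ge k_0$ $$\|\rho_k-(\rho_{k,1}+\rho_{k,2})\|_{L^2(\bar\mu)}\le\varepsilon,\quad \Big|\int|\rho_{k,1}|^2d\bar\mu-\alpha\Big|\le\varepsilon,\quad \Big|\int|\rho_{k,2}|^2d\bar\mu-(1-\alpha)\Big|\le\varepsilon,$$ and, up to $\bar\mu$-null sets, $\rho_{k,1}$ is supported where $2^{\ell_k-R}\le|y|\le2^{\ell_k+R}$ and $\rho_{k,2}$ is supported where $|y|\le2^{\ell_k-R_k}$ or $|y|\ge2^{\ell_k+R_k}$. Then for no subsequence $\{f_{n_k}\}_k$ does $\{f_{n_k}\}_k$ or $\{|f_{n_k}|\}_k$ satisfy dichotomy. In particular, this holds for dichotomy with the additional requirement that $\rho_{k,1},\rho_{k,2}$ be nonnegative. -/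

import Mathlib

open MeasureTheory Filter Topology
open scoped ENNReal

namespace OneSheetedHyperboloid

/-- The spatial variable `y ∈ ℝ³`. -/
abbrev Space : Type := EuclideanSpace ℝ (Fin 3)

/-- `ℝ⁴ = ℝ³ × ℝ`, with points written `(x, t)` and Lebesgue measure `volume`. -/
abbrev SpaceTime : Type := Space × ℝ

/-- The weighted measure `𝟙_{|y| > 1} dy / √(|y|² - 1)` on `ℝ³`. -/
noncomputable def weight : Measure Space :=
  (volume.restrict {y : Space | 1 < ‖y‖}).withDensity
    (fun y => ENNReal.ofReal (Real.sqrt (‖y‖ ^ 2 - 1))⁻¹)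

/-- The measure `μ₊` on the upper half of the hyperboloid `t² = |x|² - 1`. -/
noncomputable def muPlus : Measure SpaceTime :=
  weight.map (fun y => (y, Real.sqrt (‖y‖ ^ 2 - 1)))

/-- The measure `μ₋` on the lower half of the hyperboloid `t² = |x|² - 1`. -/
noncomputable def muMinus : Measure SpaceTime :=
  weight.map (fun y => (y, -Real.sqrt (‖y‖ ^ 2 - 1)))

/-- The Lorentz invariant measure `μ₊ + μ₋` of the full one-sheeted hyperboloid, as a measure on
`ℝ⁴` carried by the hyperboloid. The space `L²` of the hyperboloid consists of the `f` with
`MemLp f 2 muBar`. -/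
noncomputable def muBar : Measure SpaceTime := muPlus + muMinus

/-- The character `e^{i (x · y + t s)}` for `z = (x, t)` and `ξ = (y, s)`. -/
noncomputable def character (z ξ : SpaceTime) : ℂ :=
  Complex.exp (Complex.I * ((inner ℝ z.1 ξ.1 + z.2 * ξ.2 : ℝ) : ℂ))

/-- `u` is the adjoint restriction (extension) of `f`, that is
`u(x, t) = ∫ e^{i (x · y + t s)} f(y, s) dμ̄(y, s)`. For a general `f ∈ L²(μ̄)` the integral
does not converge absolutely, and the equation is that of tempered distributions: `u` is the
Fourier transform, reflected at the origin, of the tempered measure `f μ̄`. -/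
def IsExtension (f u : SpaceTime → ℂ) : Prop :=
  ∀ φ : SchwartzMap SpaceTime ℂ,
    ∫ z, u z * φ z = ∫ ξ, f ξ * (∫ z, character z ξ * φ z) ∂muBar

/-- The norm in `L⁴(ℝ⁴)` of the extension of `f`. The extension is unique almost everywhere, and
the value is `∞` if it is not a function in `L⁴(ℝ⁴)`. -/
noncomputable def extensionNorm (f : SpaceTime → ℂ) : ℝ≥0∞ :=
  ⨅ (u : SpaceTime → ℂ) (_ : MemLp u 4 volume) (_ : IsExtension f u), eLpNorm u 4 volume

/-- The best constant in `‖T̄ f‖_{L⁴(ℝ⁴)} ≤ H ‖f‖_{L²(μ̄)}`. -/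
noncomputable def bestConstant : ℝ≥0∞ :=
  ⨆ (f : SpaceTime → ℂ) (_ : MemLp f 2 muBar) (_ : ¬ f =ᵐ[muBar] 0),
    extensionNorm f / eLpNorm f 2 muBar

/-- `L²`-normalized extremizing sequences. -/
structure IsExtremizingSeq (f : ℕ → SpaceTime → ℂ) : Prop where
  memLp : ∀ n, MemLp (f n) 2 muBar
  normalized : ∀ n, eLpNorm (f n) 2 muBar = 1
  tendsto : Tendsto (fun n => extensionNorm (f n)) atTop (𝓝 bestConstant)

/-- The dichotomy alternative, with total mass `lam`, of the concentration-compactness lemma on the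
dyadic scales `|y| ∼ 2 ^ ℓ` of the hyperboloid. The two pieces are allowed to be complex valued,
and the sequences `ℓ`, `R'` may be real and may depend on `ε`; asking for nonnegative pieces, for
natural numbers `ℓ k`, or for sequences independent of `ε` gives a more restrictive condition.
The support conditions are meant up to null sets. -/
def Dichotomy (lam : ℝ) (ρ : ℕ → SpaceTime → ℂ) : Prop :=
  ∃ α ∈ Set.Ioo 0 lam, ∀ ε : ℝ, 0 < ε →
    ∃ (R k₀ : ℕ) (ρ₁ ρ₂ : ℕ → SpaceTime → ℂ) (ℓ R' : ℕ → ℝ),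
      Tendsto R' atTop atTop ∧
      ∀ k, k₀ ≤ k →
        MemLp (ρ₁ k) 2 muBar ∧ MemLp (ρ₂ k) 2 muBar ∧
        eLpNorm (fun ξ => ρ k ξ - (ρ₁ k ξ + ρ₂ k ξ)) 2 muBar ≤ ENNReal.ofReal ε ∧
        |(∫ ξ, ‖ρ₁ k ξ‖ ^ 2 ∂muBar) - α| ≤ ε ∧
        |(∫ ξ, ‖ρ₂ k ξ‖ ^ 2 ∂muBar) - (lam - α)| ≤ ε ∧
        (∀ᵐ ξ ∂muBar, ρ₁ k ξ ≠ 0 →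
          (2 : ℝ) ^ (ℓ k - R) ≤ ‖ξ.1‖ ∧ ‖ξ.1‖ ≤ (2 : ℝ) ^ (ℓ k + R)) ∧
        (∀ᵐ ξ ∂muBar, ρ₂ k ξ ≠ 0 →
          ‖ξ.1‖ ≤ (2 : ℝ) ^ (ℓ k - R' k) ∨ (2 : ℝ) ^ (ℓ k + R' k) ≤ ‖ξ.1‖)

end OneSheetedHyperboloid

/-! Pieces at widely separated dyadic scales hardly interact in `L⁴`, so the fourth power of the
norm of the extension of `ρ₁ + ρ₂` is almost the sum of the two fourth powers. With masses near `α`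
and `1 - α` and best constant `H`, that sum is at most about `H⁴ (α² + (1 - α)²)`, strictly below
`H⁴` when `0 < α < 1` and `0 < H < ∞`. Along an extremizing sequence the left side approaches `H⁴`,
which is a contradiction (`not_dichotomy_of_tendsto`).

The weak interaction is a bilinear estimate. On the upper sheet the product of two extensions is the
Fourier transform of a measure carried along the sum map `sheetSum`. Where `min |y| |y'| ≤ κ |y +
y'|`, this map pushes the product measure to one of density at most `4πκ`
(`lintegral_comp_sheetSum_le_of_min`), and `lintegral_sq_oscillatory_le` converts a density bound
into an `L²` bound by a Schur test against a Gaussian. The lower sheet is the negative of the upper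
one, so its extension is a complex conjugate and obeys the same bounds. A scale ratio `c` gives `κ =
1 / (c - 1)`, which tends to zero as the scales move apart.

The same estimate with `κ = 1` on each octant gives the bound from `L²` to `L⁴`. Hence `H` is finite
and the distributional extension exists, with a unique `L⁴` representative, for every `f ∈ L²`.
Absolute values are reduced to the functions themselves by multiplying the pieces by the phase
(`Dichotomy.of_norm`). -/

namespace OneSheetedHyperboloid

/-! ### The weight on `ℝ³` and integration in two squared distances -/

/-- The height `√(|y|² - 1)` of the upper sheet of the hyperboloid over `y`. -/
noncomputable def height (y : Space) : ℝ := Real.sqrt (‖y‖ ^ 2 - 1)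

theorem continuous_height : Continuous height := by unfold height; fun_prop

theorem measurable_height : Measurable height := continuous_height.measurable

theorem height_le_norm (y : Space) : height y ≤ ‖y‖ := by
  unfold height
  calc Real.sqrt (‖y‖ ^ 2 - 1) ≤ Real.sqrt (‖y‖ ^ 2) := Real.sqrt_le_sqrt (by linarith)
    _ = ‖y‖ := Real.sqrt_sq (norm_nonneg y)

theorem height_neg (y : Space) : height (-y) = height y := by simp [height]

/-- The restriction to `|y| > 1` is redundant: elsewhere `Real.sqrt` returns `0`, and so does its
inverse. -/
theorem weight_eq_withDensity :
    weight = volume.withDensity (fun y : Space => ENNReal.ofReal (height y)⁻¹) := by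
  have hs : MeasurableSet {y : Space | 1 < ‖y‖} :=
    measurableSet_lt measurable_const measurable_norm
  unfold weight
  rw [← withDensity_indicator hs]
  congr 1
  ext y
  by_cases h : 1 < ‖y‖
  · rw [Set.indicator_of_mem (by exact h)]; rfl
  · rw [Set.indicator_of_notMem (by exact h)]
    have : ‖y‖ ^ 2 - 1 ≤ 0 := by nlinarith [norm_nonneg y]
    simp [height, Real.sqrt_eq_zero_of_nonpos this]

theorem lintegral_weight {h : Space → ℝ≥0∞} (hh : Measurable h) :
    ∫⁻ y, h y ∂weight = ∫⁻ y : Space, ENNReal.ofReal (height y)⁻¹ * h y := by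
  rw [weight_eq_withDensity, lintegral_withDensity_eq_lintegral_mul _ _ hh]
  · rfl
  · exact measurable_height.inv.ennreal_ofReal

instance : SFinite weight := by unfold weight; infer_instance

/-- Substituting `p = a² + 1` cancels the singular weight exactly, since `dp = 2a da`; the range `p
≤ 1` contributes nothing because `0⁻¹ = 0`. -/
theorem lintegral_inv_sqrt (G : ℝ → ℝ≥0∞) :
    ∫⁻ p : ℝ, ENNReal.ofReal (Real.sqrt (p - 1))⁻¹ * G (Real.sqrt (p - 1)) =
      2 * ∫⁻ a in Set.Ioi (0 : ℝ), G a := by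
  have himg : (fun a : ℝ => a ^ 2 + 1) '' Set.Ioi 0 = Set.Ioi 1 := by
    ext p
    simp only [Set.mem_image, Set.mem_Ioi]
    constructor
    · rintro ⟨a, ha, rfl⟩; nlinarith
    · intro hp
      exact ⟨Real.sqrt (p - 1), Real.sqrt_pos.2 (by linarith), by
        rw [Real.sq_sqrt (by linarith)]; ring⟩
  have h1 := lintegral_image_eq_lintegral_abs_deriv_mul (s := Set.Ioi (0 : ℝ))
    (f := fun a => a ^ 2 + 1) (f' := fun a => 2 * a) measurableSet_Ioi
    (fun x _ => by simpa using ((hasDerivAt_pow 2 x).add_const 1).hasDerivWithinAt)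
    (fun a ha b hb hab => by
      simp only [Set.mem_Ioi] at ha hb
      simp only [add_left_inj] at hab
      exact (pow_left_inj₀ ha.le hb.le two_ne_zero).1 hab)
    (fun p => ENNReal.ofReal (Real.sqrt (p - 1))⁻¹ * G (Real.sqrt (p - 1)))
  rw [himg] at h1
  have h2 : ∫⁻ p : ℝ, ENNReal.ofReal (Real.sqrt (p - 1))⁻¹ * G (Real.sqrt (p - 1)) =
      ∫⁻ p in Set.Ioi 1, ENNReal.ofReal (Real.sqrt (p - 1))⁻¹ * G (Real.sqrt (p - 1)) := by
    rw [← lintegral_indicator measurableSet_Ioi]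
    congr 1
    ext p
    by_cases h : 1 < p
    · rw [Set.indicator_of_mem (by exact h)]
    · rw [Set.indicator_of_notMem (by exact h), Real.sqrt_eq_zero_of_nonpos (by linarith)]
      simp
  rw [h2, h1, ← lintegral_const_mul' _ _ (by simp)]
  refine setLIntegral_congr_fun measurableSet_Ioi fun a ha => ?_
  have ha : 0 < a := ha
  simp only [add_sub_cancel_right, Real.sqrt_sq ha.le]
  rw [← mul_assoc, ← ENNReal.ofReal_mul (abs_nonneg _), abs_of_pos (by linarith)]
  congr 1
  rw [mul_assoc, mul_inv_cancel₀ ha.ne']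
  simp

/-- Polar coordinates followed by `q = r²`: the angle gives `2π` and the substitution gives `1/2`.
-/
theorem lintegral_comp_sq_add_sq {G : ℝ → ℝ≥0∞} (hG : Measurable G) :
    ∫⁻ v : ℝ × ℝ, G (v.1 ^ 2 + v.2 ^ 2) =
      ENNReal.ofReal Real.pi * ∫⁻ q in Set.Ioi (0 : ℝ), G q := by
  rw [← lintegral_comp_polarCoord_symm]
  have himg : (fun a : ℝ => a ^ 2) '' Set.Ioi 0 = Set.Ioi 0 := by
    ext p
    simp only [Set.mem_image, Set.mem_Ioi]
    constructor
    · rintro ⟨a, ha, rfl⟩; positivity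
    · intro hp
      exact ⟨Real.sqrt p, Real.sqrt_pos.2 hp, Real.sq_sqrt hp.le⟩
  have h1 := lintegral_image_eq_lintegral_abs_deriv_mul (s := Set.Ioi (0 : ℝ))
    (f := fun a => a ^ 2) (f' := fun a => 2 * a) measurableSet_Ioi
    (fun x _ => by simpa using (hasDerivAt_pow 2 x).hasDerivWithinAt)
    (fun a ha b hb hab => (pow_left_inj₀ (le_of_lt ha) (le_of_lt hb) two_ne_zero).1 hab) G
  rw [himg] at h1
  have h2 : ∀ p : ℝ × ℝ, ENNReal.ofReal p.1 •
      G ((polarCoord.symm p).1 ^ 2 + (polarCoord.symm p).2 ^ 2) =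
      (ENNReal.ofReal p.1 * G (p.1 ^ 2)) * 1 := by
    intro p
    have : (p.1 * Real.cos p.2) ^ 2 + (p.1 * Real.sin p.2) ^ 2 = p.1 ^ 2 := by
      linear_combination p.1 ^ 2 * Real.sin_sq_add_cos_sq p.2
    simp [polarCoord, this]
  simp_rw [h2]
  rw [polarCoord_target, Measure.volume_eq_prod, ← Measure.prod_restrict,
    lintegral_prod_mul (f := fun r : ℝ => ENNReal.ofReal r * G (r ^ 2)) (g := fun _ => 1)
      (by fun_prop) (by fun_prop), h1]
  simp only [lintegral_const, MeasurableSet.univ, Measure.restrict_apply, Set.univ_inter,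
    Real.volume_Ioo, one_mul]
  have h3 : ∀ a ∈ Set.Ioi (0 : ℝ), ENNReal.ofReal |2 * a| * G (a ^ 2) =
      2 * (ENNReal.ofReal a * G (a ^ 2)) := by
    intro a ha
    have ha : 0 < a := ha
    rw [abs_of_pos (by linarith), ENNReal.ofReal_mul (by norm_num), mul_assoc]
    simp
  rw [setLIntegral_congr_fun measurableSet_Ioi h3, lintegral_const_mul' _ _ (by simp),
    ← mul_assoc, mul_comm]
  congr 1
  rw [show (2 : ℝ≥0∞) = ENNReal.ofReal 2 by simp, ← ENNReal.ofReal_mul Real.pi_pos.le]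
  congr 1; ring

/-- Integration over `ℝ³` in the coordinates `(y₀, (y₁, y₂))`. -/
theorem lintegral_space {h : Space → ℝ≥0∞} (hh : Measurable h) :
    ∫⁻ y, h y = ∫⁻ a : ℝ, ∫⁻ v : ℝ × ℝ, h (!₂[a, v.1, v.2]) := by
  have e1 := (EuclideanSpace.volume_preserving_symm_measurableEquiv_toLp (Fin 3)).symm
  have e2 := (volume_preserving_piFinSuccAbove (fun _ : Fin 3 => ℝ) 0).symm
  have e3 := (volume_preserving_finTwoArrow ℝ).symm
  have e4 := (MeasurePreserving.id (volume : Measure ℝ)).prod e3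
  rw [← e1.lintegral_comp hh, ← e2.lintegral_comp (by fun_prop)]
  have hm : Measurable (fun p : ℝ × (Fin 2 → ℝ) =>
      h ((MeasurableEquiv.toLp 2 (Fin 3 → ℝ)).symm.symm
        ((MeasurableEquiv.piFinSuccAbove (fun _ : Fin 3 => ℝ) 0).symm p))) :=
    hh.comp ((MeasurableEquiv.measurable _).comp (MeasurableEquiv.measurable _))
  have := e4.lintegral_comp (f := fun p => h ((MeasurableEquiv.toLp 2 (Fin 3 → ℝ)).symm.symm
    ((MeasurableEquiv.piFinSuccAbove (fun _ : Fin 3 => ℝ) 0).symm p))) hm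
  rw [Measure.volume_eq_prod]
  erw [← this]
  refine (lintegral_prod _ (hm.comp e4.measurable).aemeasurable).trans ?_
  refine lintegral_congr fun a => lintegral_congr fun v => ?_
  refine congrArg h (PiLp.ext fun i => ?_)
  fin_cases i <;> rfl

theorem lintegral_affine {G : ℝ → ℝ≥0∞} (hG : Measurable G) {c : ℝ} (hc : c ≠ 0) (d : ℝ) :
    ∫⁻ a, G (d + c * a) = ENNReal.ofReal |c⁻¹| * ∫⁻ q, G q := by
  have h1 : ∫⁻ a, G (d + c * a) = ∫⁻ b, G (d + b) ∂(Measure.map (fun a => c * a) volume) := by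
    rw [lintegral_map (by fun_prop) (by fun_prop)]
  rw [h1, Real.map_volume_mul_left hc, lintegral_smul_measure, lintegral_add_left_eq_self]
  rfl

/-- Integrating a function of the distances to two points costs at most a two dimensional integral
over the squares of the distances. -/
theorem lintegral_two_dist_le {F : ℝ → ℝ → ℝ≥0∞} (hF : Measurable (Function.uncurry F))
    {ξ : Space} (hξ : ξ ≠ 0) :
    ∫⁻ y : Space, F (‖y‖ ^ 2) (‖ξ - y‖ ^ 2) ≤
      ENNReal.ofReal (Real.pi / (2 * ‖ξ‖)) * ∫⁻ p, ∫⁻ q, F p q := by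
  have hF' : ∀ {X : Type} [MeasurableSpace X] {u v : X → ℝ}, Measurable u → Measurable v →
      Measurable fun x => F (u x) (v x) := fun hu hv => hF.comp (hu.prodMk hv)
  set L := ‖ξ‖ with hL
  have hLpos : 0 < L := norm_pos_iff.2 hξ
  set e : Space := EuclideanSpace.single 0 L with he
  have hne : ‖ξ‖ = ‖e‖ := by simp [he, hL]
  -- This reflection exchanges `e` and `ξ`, so `ξ` may be assumed to lie on the first axis.
  set R := (ℝ ∙ (ξ - e))ᗮ.reflection with hR
  have hRe : R e = ξ := by
    rw [← Submodule.reflection_sub hne, ← hR]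
    exact Submodule.reflection_reflection _ _
  have h1 : ∫⁻ y : Space, F (‖y‖ ^ 2) (‖ξ - y‖ ^ 2) =
      ∫⁻ y : Space, F (‖y‖ ^ 2) (‖e - y‖ ^ 2) := by
    rw [← R.measurePreserving.lintegral_comp (hF' (by fun_prop) (by fun_prop))]
    refine lintegral_congr fun y => ?_
    rw [R.norm_map, ← hRe, ← map_sub, R.norm_map]
  rw [h1, lintegral_space (hF' (by fun_prop) (by fun_prop))]
  -- In cylindrical coordinates with `p = ‖y‖²`, the other squared distance is `p + L² - 2La`,
  -- affine in the axial variable `a`.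
  have h2 : ∀ a : ℝ, ∫⁻ v : ℝ × ℝ,
      F (‖(!₂[a, v.1, v.2] : Space)‖ ^ 2) (‖e - (!₂[a, v.1, v.2] : Space)‖ ^ 2) ≤
      ENNReal.ofReal Real.pi * ∫⁻ p, F p (p + L ^ 2 + (-2 * L) * a) := by
    intro a
    have h3 : ∀ v : ℝ × ℝ,
        F (‖(!₂[a, v.1, v.2] : Space)‖ ^ 2) (‖e - (!₂[a, v.1, v.2] : Space)‖ ^ 2) =
        (fun q => F (a ^ 2 + q) ((a ^ 2 + q) + L ^ 2 + (-2 * L) * a)) (v.1 ^ 2 + v.2 ^ 2) := by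
      intro v
      simp only [EuclideanSpace.norm_sq_eq, Fin.sum_univ_three, he]
      simp
      congr 1 <;> ring
    simp_rw [h3]
    rw [lintegral_comp_sq_add_sq (G := fun q => F (a ^ 2 + q) ((a ^ 2 + q) + L ^ 2 + (-2 * L) * a))
      (hF' (by fun_prop) (by fun_prop))]
    -- The only loss: the constraint `p > a²` is dropped.
    refine mul_le_mul' le_rfl ((setLIntegral_le_lintegral _ _).trans_eq ?_)
    exact lintegral_add_left_eq_self (fun p => F p (p + L ^ 2 + (-2 * L) * a)) (a ^ 2)
  refine (lintegral_mono h2).trans_eq ?_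
  rw [lintegral_const_mul' _ _ (by simp), lintegral_lintegral_swap
    (f := fun a p => F p (p + L ^ 2 + (-2 * L) * a))
    (Measurable.aemeasurable (hF' (by fun_prop) (by fun_prop)))]
  have h4 : ∀ p, ∫⁻ a, F p (p + L ^ 2 + (-2 * L) * a) =
      ENNReal.ofReal (1 / (2 * L)) * ∫⁻ q, F p q := by
    intro p
    rw [lintegral_affine (G := F p) (hF' measurable_const measurable_id) (by nlinarith)]
    congr 2
    rw [abs_inv, abs_mul, abs_of_pos hLpos]; norm_num
  rw [lintegral_congr h4, lintegral_const_mul' _ _ (by simp), ← mul_assoc,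
    ← ENNReal.ofReal_mul Real.pi_pos.le]
  congr 2
  ring

/-- Local finiteness makes an `L²` function integrable after truncation to a slab. An auxiliary unit
vector `ξ` brings in the two-distance bound; the cutoff in `q` costs nothing, as `‖ξ - y‖ ≤ 1 + r`
on the ball. -/
theorem weight_closedBall_lt_top (r : ℝ) : weight {y | ‖y‖ ≤ r} < ∞ := by
  have hs : MeasurableSet {y : Space | ‖y‖ ≤ r} := measurableSet_le measurable_norm measurable_const
  set ξ : Space := EuclideanSpace.single 0 1 with hξ
  have hξ1 : ‖ξ‖ = 1 := by simp [hξ]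
  have hξ0 : ξ ≠ 0 := by intro h; simp [h] at hξ1
  set A : ℝ → ℝ≥0∞ := fun p =>
    ENNReal.ofReal (Real.sqrt (p - 1))⁻¹ * (Set.Iic |r|).indicator 1 (Real.sqrt (p - 1)) with hA
  set B : ℝ → ℝ≥0∞ := (Set.Icc 0 ((1 + |r|) ^ 2)).indicator 1 with hB
  have hBm : Measurable B := measurable_one.indicator measurableSet_Icc
  have hAm : Measurable A := by
    have : Measurable ((Set.Iic |r|).indicator (1 : ℝ → ℝ≥0∞)) :=
      measurable_one.indicator measurableSet_Iic
    fun_prop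
  have h1 : weight {y | ‖y‖ ≤ r} ≤ ∫⁻ y : Space, A (‖y‖ ^ 2) * B (‖ξ - y‖ ^ 2) := by
    rw [← lintegral_indicator_one hs, lintegral_weight (measurable_one.indicator hs)]
    refine lintegral_mono fun y => ?_
    by_cases hy : ‖y‖ ≤ r
    · have hr : |r| = r := abs_of_nonneg ((norm_nonneg y).trans hy)
      have h2 : ‖ξ - y‖ ≤ 1 + r := (norm_sub_le _ _).trans (by linarith)
      have h3 : height y ≤ |r| := (height_le_norm y).trans (hy.trans_eq hr.symm)
      have h4 : ‖ξ - y‖ ^ 2 ∈ Set.Icc 0 ((1 + |r|) ^ 2) :=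
        ⟨by positivity, by rw [hr]; gcongr⟩
      simp only [hA, hB]
      rw [Set.indicator_of_mem h4, Set.indicator_of_mem (s := Set.Iic |r|) (by exact h3),
        Set.indicator_of_mem (by exact hy)]
      simp [height]
    · simp [hy]
  refine h1.trans_lt ((lintegral_two_dist_le (F := fun p q => A p * B q)
    (by unfold Function.uncurry; fun_prop) hξ0).trans_lt ?_)
  rw [lintegral_congr (fun p => lintegral_const_mul (A p) hBm),
    lintegral_mul_const _ hAm, hA, lintegral_inv_sqrt]
  refine ENNReal.mul_lt_top (by simp) (ENNReal.mul_lt_top (ENNReal.mul_lt_top (by simp) ?_) ?_)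
  · rw [lintegral_indicator_one₀ measurableSet_Iic.nullMeasurableSet,
      Measure.restrict_apply measurableSet_Iic, Set.inter_comm, Set.Ioi_inter_Iic]
    simp
  · rw [hB, lintegral_indicator_one measurableSet_Icc]
    simp

/-! ### Density of the sum of two points of the sheet -/

/-- The sum of two points of the upper sheet of the hyperboloid. -/
noncomputable def sheetSum (p : Space × Space) : SpaceTime :=
  (p.1 + p.2, height p.1 + height p.2)

theorem measurable_sheetSum : Measurable sheetSum := by
  have := measurable_height
  unfold sheetSum; fun_prop

/-- Fix `ξ = y + y'` and use the two heights `a`, `b` as coordinates: both weights cancel, leaving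
`2π / ‖ξ‖` times the integral of `h (ξ, a + b)` over `a`, `b`. The restriction `a ≤ κ ‖ξ‖` then
compensates the factor `1 / ‖ξ‖`. -/
theorem lintegral_comp_sheetSum_le {h : SpaceTime → ℝ≥0∞} (hh : Measurable h) (κ : ℝ) :
    ∫⁻ p in {p : Space × Space | height p.1 ≤ κ * ‖p.1 + p.2‖}, h (sheetSum p)
        ∂(weight.prod weight) ≤
      ENNReal.ofReal (2 * Real.pi * κ) * ∫⁻ z, h z := by
  have hm := measurable_height
  have hS : MeasurableSet {p : Space × Space | height p.1 ≤ κ * ‖p.1 + p.2‖} :=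
    measurableSet_le (by fun_prop) (by fun_prop)
  set I : ℝ × ℝ → ℝ≥0∞ := ({x | x.1 ≤ κ * x.2} : Set (ℝ × ℝ)).indicator 1 with hI
  have hIm : Measurable I :=
    measurable_one.indicator (measurableSet_le (by fun_prop) (by fun_prop))
  set W : Space → ℝ≥0∞ := fun y => ENNReal.ofReal (height y)⁻¹ with hW
  have hWm : Measurable W := by fun_prop
  have h1 : ∫⁻ p in {p : Space × Space | height p.1 ≤ κ * ‖p.1 + p.2‖}, h (sheetSum p)
      ∂(weight.prod weight) = ∫⁻ y : Space, ∫⁻ ξ : Space,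
        W y * (W (ξ - y) * (I (height y, ‖ξ‖) * h (ξ, height y + height (ξ - y)))) := by
    have hin : ∀ p : Space × Space, ({p : Space × Space | height p.1 ≤ κ * ‖p.1 + p.2‖}).indicator
        (fun p => h (sheetSum p)) p = I (height p.1, ‖p.1 + p.2‖) * h (sheetSum p) := by
      intro p
      by_cases hp : height p.1 ≤ κ * ‖p.1 + p.2‖
      · rw [Set.indicator_of_mem (by exact hp), hI, Set.indicator_of_mem (by exact hp)]; simp
      · rw [Set.indicator_of_notMem (by exact hp), hI, Set.indicator_of_notMem (by exact hp)]
        simp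
    rw [← lintegral_indicator hS, lintegral_congr hin]
    unfold sheetSum
    rw [lintegral_prod _ (by fun_prop), lintegral_weight (by fun_prop)]
    refine lintegral_congr fun y => ?_
    rw [lintegral_weight (by fun_prop), ← lintegral_const_mul _ (by fun_prop),
      ← lintegral_add_left_eq_self _ (-y)]
    refine lintegral_congr fun ξ => ?_
    simp only [hW, neg_add_eq_sub, add_sub_cancel]
  have hjm : Measurable (fun x : Space × Space => W x.1 * (W (x.2 - x.1) *
      (I (height x.1, ‖x.2‖) * h (x.2, height x.1 + height (x.2 - x.1))))) := by fun_prop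
  rw [h1, lintegral_lintegral_swap hjm.aemeasurable, Measure.volume_eq_prod,
    lintegral_prod _ hh.aemeasurable, ← lintegral_const_mul' _ _ (by simp)]
  refine lintegral_mono_ae ?_
  have h0 : ∀ᵐ ξ : Space, ξ ≠ 0 := by
    simp [ae_iff]
  filter_upwards [h0] with ξ hξ
  have hL : 0 < ‖ξ‖ := norm_pos_iff.2 hξ
  set F : ℝ → ℝ → ℝ≥0∞ := fun p q => ENNReal.ofReal (Real.sqrt (p - 1))⁻¹ *
    (ENNReal.ofReal (Real.sqrt (q - 1))⁻¹ * (I (Real.sqrt (p - 1), ‖ξ‖) *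
      h (ξ, Real.sqrt (p - 1) + Real.sqrt (q - 1)))) with hF
  have hFm : Measurable (Function.uncurry F) := by unfold Function.uncurry; simp only [hF]; fun_prop
  refine (lintegral_two_dist_le hFm hξ).trans ?_
  have h2 : ∀ p, ∫⁻ q, F p q = ENNReal.ofReal (Real.sqrt (p - 1))⁻¹ *
      (fun a => 2 * ∫⁻ b in Set.Ioi (0 : ℝ), I (a, ‖ξ‖) * h (ξ, a + b)) (Real.sqrt (p - 1)) := by
    intro p
    simp only [hF]
    rw [lintegral_const_mul _ (by fun_prop), lintegral_inv_sqrt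
      (fun b => I (Real.sqrt (p - 1), ‖ξ‖) * h (ξ, Real.sqrt (p - 1) + b))]
  simp_rw [h2]
  rw [lintegral_inv_sqrt (fun a => 2 * ∫⁻ b in Set.Ioi (0 : ℝ), I (a, ‖ξ‖) * h (ξ, a + b))]
  have h3 : ∀ a : ℝ, 2 * ∫⁻ b in Set.Ioi (0 : ℝ), I (a, ‖ξ‖) * h (ξ, a + b) ≤
      (Set.Iic (κ * ‖ξ‖)).indicator (fun _ => 2 * ∫⁻ τ, h (ξ, τ)) a := by
    intro a
    by_cases ha : a ≤ κ * ‖ξ‖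
    · rw [Set.indicator_of_mem (by exact ha)]
      have : I (a, ‖ξ‖) = 1 := by rw [hI, Set.indicator_of_mem (by exact ha)]; rfl
      simp only [this, one_mul]
      refine mul_le_mul' le_rfl ((setLIntegral_le_lintegral _ _).trans_eq ?_)
      exact lintegral_add_left_eq_self (fun τ => h (ξ, τ)) a
    · have : I (a, ‖ξ‖) = 0 := by rw [hI, Set.indicator_of_notMem (by exact ha)]
      simp [this]
  calc ENNReal.ofReal (Real.pi / (2 * ‖ξ‖)) *
        (2 * ∫⁻ a in Set.Ioi (0 : ℝ), 2 * ∫⁻ b in Set.Ioi (0 : ℝ), I (a, ‖ξ‖) * h (ξ, a + b))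
      ≤ ENNReal.ofReal (Real.pi / (2 * ‖ξ‖)) * (2 * ∫⁻ a in Set.Ioi (0 : ℝ),
          (Set.Iic (κ * ‖ξ‖)).indicator (fun _ => 2 * ∫⁻ τ, h (ξ, τ)) a) := by
        gcongr with a
        exact h3 a
    _ = ENNReal.ofReal (Real.pi / (2 * ‖ξ‖)) * (2 *
          ((2 * ∫⁻ τ, h (ξ, τ)) * ENNReal.ofReal (κ * ‖ξ‖))) := by
        rw [lintegral_indicator measurableSet_Iic, Measure.restrict_restrict measurableSet_Iic,
          Set.inter_comm, Set.Ioi_inter_Iic]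
        simp
    _ = (ENNReal.ofReal (Real.pi / (2 * ‖ξ‖)) * (ENNReal.ofReal 2 * ENNReal.ofReal 2 *
          ENNReal.ofReal (κ * ‖ξ‖))) * ∫⁻ τ, h (ξ, τ) := by
        simp only [ENNReal.ofReal_ofNat]; ring
    _ = ENNReal.ofReal (2 * Real.pi * κ) * ∫⁻ τ, h (ξ, τ) := by
        rw [← ENNReal.ofReal_mul (by norm_num), ← ENNReal.ofReal_mul (by norm_num),
          ← ENNReal.ofReal_mul (by positivity)]
        congr 2
        field_simp

/-- The sumset map of two points of the sheet, of which one is small compared with the sum, pushes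
the product measure to a measure with bounded density. -/
theorem lintegral_comp_sheetSum_le_of_min {h : SpaceTime → ℝ≥0∞} (hh : Measurable h) {κ : ℝ}
    (hκ : 0 ≤ κ) :
    ∫⁻ p in {p : Space × Space | min ‖p.1‖ ‖p.2‖ ≤ κ * ‖p.1 + p.2‖}, h (sheetSum p)
        ∂(weight.prod weight) ≤
      ENNReal.ofReal (4 * Real.pi * κ) * ∫⁻ z, h z := by
  have hm := measurable_height
  set S : Set (Space × Space) := {p | height p.1 ≤ κ * ‖p.1 + p.2‖} with hS
  have hSm : MeasurableSet S := measurableSet_le (by fun_prop) (by fun_prop)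
  -- Either point may be the smaller one; exchanging the two preserves the sum, so the second case
  -- costs the same constant.
  have hsub : {p : Space × Space | min ‖p.1‖ ‖p.2‖ ≤ κ * ‖p.1 + p.2‖} ⊆
      S ∪ Prod.swap ⁻¹' S := by
    intro p hp
    rcases min_le_iff.1 hp.out with h | h
    · exact Or.inl ((height_le_norm _).trans h)
    · refine Or.inr ((height_le_norm _).trans ?_)
      simpa [add_comm] using h
  refine (lintegral_mono_set hsub).trans ((lintegral_union_le _ _ _).trans ?_)
  have hsw : ∫⁻ p in Prod.swap ⁻¹' S, h (sheetSum p) ∂(weight.prod weight) =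
      ∫⁻ p in S, h (sheetSum p) ∂(weight.prod weight) := by
    refine Eq.trans ?_ ((Measure.measurePreserving_swap (μ := weight)
      (ν := weight)).setLIntegral_comp_preimage hSm (hh.comp measurable_sheetSum))
    refine lintegral_congr fun p => ?_
    simp [sheetSum, add_comm]
  rw [hsw]
  refine (add_le_add (lintegral_comp_sheetSum_le hh κ)
    (lintegral_comp_sheetSum_le hh κ)).trans_eq ?_
  rw [← add_mul, ← ENNReal.ofReal_add (by positivity) (by positivity)]
  congr 2; ring

/-! ### Characters, Gaussians and the `L²` bound for oscillatory integrals -/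

theorem continuous_character : Continuous fun p : SpaceTime × SpaceTime => character p.1 p.2 := by
  unfold character
  fun_prop

theorem measurable_character : Measurable fun p : SpaceTime × SpaceTime => character p.1 p.2 :=
  continuous_character.measurable

@[simp] theorem norm_character (z ξ : SpaceTime) : ‖character z ξ‖ = 1 := by
  unfold character
  rw [mul_comm, Complex.norm_exp_ofReal_mul_I]

theorem character_add (z ξ η : SpaceTime) :
    character z (ξ + η) = character z ξ * character z η := by
  unfold character
  rw [← Complex.exp_add]
  congr 1
  simp [inner_add_right]
  ring

theorem conj_character (z ξ : SpaceTime) :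
    (starRingEnd ℂ) (character z ξ) = character z (-ξ) := by
  unfold character
  rw [← Complex.exp_conj]
  congr 1
  simp
  ring

theorem character_sub (z ξ η : SpaceTime) :
    character z (ξ - η) = character z ξ * (starRingEnd ℂ) (character z η) := by
  rw [conj_character, ← character_add, sub_eq_add_neg]

/-- A Gaussian on space-time. -/
noncomputable def gauss (b : ℝ) (z : SpaceTime) : ℝ :=
  Real.exp (-b * ‖z.1‖ ^ 2) * Real.exp (-b * ‖z.2‖ ^ 2)

theorem gauss_nonneg (b : ℝ) (z : SpaceTime) : 0 ≤ gauss b z := by unfold gauss; positivity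

theorem measurable_character_comp {Y : Type*} [MeasurableSpace Y] {u v : Y → SpaceTime}
    (hu : Measurable u) (hv : Measurable v) : Measurable fun y => character (u y) (v y) := by
  have h := measurable_character.comp (hu.prodMk hv)
  exact h

instance : (volume : Measure SpaceTime).IsAddHaarMeasure :=
  inferInstanceAs ((volume : Measure Space).prod (volume : Measure ℝ)).IsAddHaarMeasure

theorem continuous_gauss (b : ℝ) : Continuous (gauss b) := by unfold gauss; fun_prop

theorem gauss_neg (b : ℝ) (z : SpaceTime) : gauss b (-z) = gauss b z := by simp [gauss]

theorem integrable_rexp_neg_mul_sq_norm {V : Type*} [NormedAddCommGroup V] [InnerProductSpace ℝ V]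
    [FiniteDimensional ℝ V] [MeasurableSpace V] [BorelSpace V] {b : ℝ} (hb : 0 < b) :
    Integrable fun v : V => Real.exp (-b * ‖v‖ ^ 2) := by
  have := (GaussianFourier.integrable_cexp_neg_mul_sq_norm_add (b := (b : ℂ)) (by simpa using hb)
    0 (0 : V)).norm
  refine this.congr (Eventually.of_forall fun v => ?_)
  simp [Complex.norm_exp, ← Complex.ofReal_pow]

theorem integrable_gauss {b : ℝ} (hb : 0 < b) : Integrable (gauss b) :=
  (integrable_rexp_neg_mul_sq_norm hb).mul_prod (integrable_rexp_neg_mul_sq_norm hb)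

theorem rpow_three_halves_mul_half {x : ℝ} (hx : 0 < x) :
    x ^ (3 / 2 : ℝ) * x ^ (1 / 2 : ℝ) = x ^ 2 := by
  rw [← Real.rpow_add hx]; norm_num

theorem integral_gauss {b : ℝ} (hb : 0 < b) : ∫ z, gauss b z = (Real.pi / b) ^ 2 := by
  unfold gauss
  rw [Measure.volume_eq_prod, integral_prod_mul (fun x : Space => Real.exp (-b * ‖x‖ ^ 2))
    (fun t : ℝ => Real.exp (-b * ‖t‖ ^ 2)), GaussianFourier.integral_rexp_neg_mul_sq_norm hb,
    GaussianFourier.integral_rexp_neg_mul_sq_norm hb]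
  rw [finrank_euclideanSpace_fin, Module.finrank_self]
  have := rpow_three_halves_mul_half (x := Real.pi / b) (by positivity)
  exact_mod_cast this

/-- The transform of the damping factor is again a positive Gaussian, which is what the Schur test
needs; the exponents `3/2` and `1/2` come from the dimensions `3` and `1`. -/
theorem integral_gauss_mul_character {b : ℝ} (hb : 0 < b) (ζ : SpaceTime) :
    ∫ z, (gauss b z : ℂ) * character z ζ =
      (((Real.pi / b) ^ 2 * gauss (1 / (4 * b)) ζ : ℝ) : ℂ) := by
  have hb' : 0 < (b : ℂ).re := by simpa using hb
  have h1 : ∀ z : SpaceTime, (gauss b z : ℂ) * character z ζ =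
      Complex.exp (-b * ‖z.1‖ ^ 2 + Complex.I * (inner ℝ ζ.1 z.1 : ℝ)) *
      Complex.exp (-b * ‖z.2‖ ^ 2 + Complex.I * (inner ℝ ζ.2 z.2 : ℝ)) := by
    intro z
    unfold gauss character
    push_cast
    rw [← Complex.exp_add, ← Complex.exp_add, ← Complex.exp_add]
    congr 1
    rw [real_inner_comm]
    simp
    ring
  simp_rw [h1]
  rw [Measure.volume_eq_prod, integral_prod_mul
    (fun x : Space => Complex.exp (-b * ‖x‖ ^ 2 + Complex.I * (inner ℝ ζ.1 x : ℝ)))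
    (fun t : ℝ => Complex.exp (-b * ‖t‖ ^ 2 + Complex.I * (inner ℝ ζ.2 t : ℝ))),
    GaussianFourier.integral_cexp_neg_mul_sq_norm_add hb',
    GaussianFourier.integral_cexp_neg_mul_sq_norm_add hb']
  rw [finrank_euclideanSpace_fin, Module.finrank_self]
  have h2 : ((Real.pi : ℂ) / b) ^ ((3 : ℂ) / 2) * ((Real.pi : ℂ) / b) ^ ((1 : ℂ) / 2) =
      (((Real.pi / b) ^ 2 : ℝ) : ℂ) := by
    rw [← rpow_three_halves_mul_half (x := Real.pi / b) (by positivity), Complex.ofReal_mul,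
      Complex.ofReal_cpow (by positivity), Complex.ofReal_cpow (by positivity)]
    push_cast; rfl
  rw [Complex.ofReal_mul, ← h2]
  unfold gauss
  push_cast
  have h3 : ∀ r : ℝ, Complex.exp (Complex.I ^ 2 * (r : ℂ) ^ 2 / (4 * b)) =
      Complex.exp (-(1 / (4 * b)) * (r : ℂ) ^ 2) := by
    intro r
    congr 1
    rw [Complex.I_sq]; ring
  rw [h3, h3]
  ring

theorem integrable_character_mul {X : Type*} [MeasurableSpace X] {ν : Measure X}
    {σ : X → SpaceTime} (hσ : Measurable σ) {F : X → ℂ} (hF : Integrable F ν) (z : SpaceTime) :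
    Integrable (fun p => character z (σ p) * F p) ν :=
  hF.bdd_mul (c := 1) (measurable_character_comp measurable_const hσ).aestronglyMeasurable
    (Eventually.of_forall fun p => by simp)

theorem continuous_oscillatory {X : Type*} [MeasurableSpace X] {ν : Measure X}
    {σ : X → SpaceTime} (hσ : Measurable σ) {F : X → ℂ} (hF : Integrable F ν) :
    Continuous fun z => ∫ p, character z (σ p) * F p ∂ν := by
  refine continuous_of_dominated (bound := fun p => ‖F p‖)
    (fun z => (integrable_character_mul hσ hF z).1)
    (fun z => Eventually.of_forall fun p => by simp) hF.norm
    (Eventually.of_forall fun p => ?_)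
  unfold character
  fun_prop

/-- The pointwise AM–GM step of the Schur test for a nonnegative kernel. -/
theorem enorm_kernel_mul_le {g : ℝ} (hg : 0 ≤ g) (a b : ℂ) :
    ‖(g : ℂ) * (a * (starRingEnd ℂ) b)‖ₑ ≤
      2⁻¹ * (‖a‖ₑ ^ 2 * ENNReal.ofReal g + ‖b‖ₑ ^ 2 * ENNReal.ofReal g) := by
  have h2 : ‖a‖ * ‖b‖ ≤ 2⁻¹ * (‖a‖ ^ 2 + ‖b‖ ^ 2) := by
    nlinarith [sq_nonneg (‖a‖ - ‖b‖)]
  have h3 := mul_le_mul_of_nonneg_left h2 hg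
  simp only [← ofReal_norm]
  rw [show (2⁻¹ : ℝ≥0∞) = ENNReal.ofReal 2⁻¹ by
    rw [ENNReal.ofReal_inv_of_pos two_pos, ENNReal.ofReal_ofNat]]
  rw [← ENNReal.ofReal_pow (norm_nonneg _), ← ENNReal.ofReal_pow (norm_nonneg _),
    ← ENNReal.ofReal_mul (by positivity), ← ENNReal.ofReal_mul (by positivity),
    ← ENNReal.ofReal_add (by positivity) (by positivity), ← ENNReal.ofReal_mul (by positivity)]
  refine ENNReal.ofReal_le_ofReal ?_
  rw [norm_mul, norm_mul, Complex.norm_real, Real.norm_of_nonneg hg, RCLike.norm_conj]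
  linarith

/-- The `L²` norm of the Fourier transform of a measure `σ_*(F ν)` whose underlying positive measure
`σ_* ν` has density at most `C`, damped by a Gaussian. -/
theorem lintegral_sq_oscillatory_gauss_le {X : Type*} [MeasurableSpace X] {ν : Measure X}
    [SFinite ν] {σ : X → SpaceTime} (hσ : Measurable σ) {C : ℝ≥0∞}
    (hC : ∀ h : SpaceTime → ℝ≥0∞, Measurable h → ∫⁻ p, h (σ p) ∂ν ≤ C * ∫⁻ z, h z)
    {F : X → ℂ} (hF : Integrable F ν) {b : ℝ} (hb : 0 < b) :
    ∫⁻ z, ENNReal.ofReal (gauss b z) * ‖∫ p, character z (σ p) * F p ∂ν‖ₑ ^ 2 ≤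
      ENNReal.ofReal (16 * Real.pi ^ 4) * C * ∫⁻ p, ‖F p‖ₑ ^ 2 ∂ν := by
  set U : SpaceTime → ℂ := fun z => ∫ p, character z (σ p) * F p ∂ν with hU
  set Γ : SpaceTime → ℝ := fun ζ => (Real.pi / b) ^ 2 * gauss (1 / (4 * b)) ζ with hΓ
  have hΓ0 : ∀ ζ, 0 ≤ Γ ζ := fun ζ => mul_nonneg (by positivity) (gauss_nonneg _ _)
  have hΓc : Continuous Γ := continuous_const.mul (continuous_gauss _)
  have hΓm : Measurable Γ := hΓc.measurable
  -- The mass `(2π)⁴` of the kernel does not depend on `b`, so the bound survives the removal of the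
  -- damping.
  have hΓi : ∫⁻ ζ, ENNReal.ofReal (Γ ζ) = ENNReal.ofReal (16 * Real.pi ^ 4) := by
    rw [← ofReal_integral_eq_lintegral_ofReal ((integrable_gauss (by positivity)).const_mul _)
      (Eventually.of_forall hΓ0), integral_const_mul, integral_gauss (by positivity)]
    congr 1
    field_simp
    norm_num
  have hchar : Measurable fun x : SpaceTime × X × X => character x.1 (σ x.2.1 - σ x.2.2) :=
    measurable_character_comp measurable_fst
      ((hσ.comp (measurable_fst.comp measurable_snd)).sub
        (hσ.comp (measurable_snd.comp measurable_snd)))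
  have hFc : Integrable (fun p => (starRingEnd ℂ) (F p)) ν :=
    hF.mono (Complex.continuous_conj.comp_aestronglyMeasurable hF.1)
      (Eventually.of_forall fun p => by simp)
  have hFF : Integrable (fun q : X × X => F q.1 * (starRingEnd ℂ) (F q.2)) (ν.prod ν) := by
    exact hF.mul_prod hFc
  have hU2 : ∀ z, ((gauss b z * ‖U z‖ ^ 2 : ℝ) : ℂ) = ∫ q : X × X, (gauss b z : ℂ) *
      (character z (σ q.1 - σ q.2) * (F q.1 * (starRingEnd ℂ) (F q.2))) ∂(ν.prod ν) := by
    intro z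
    rw [integral_const_mul]
    push_cast
    congr 1
    rw [← Complex.mul_conj', hU]
    simp only
    rw [← integral_conj, ← integral_prod_mul]
    congr 1
    ext q
    rw [character_sub, map_mul]
    ring
  have hint : Integrable (Function.uncurry fun (z : SpaceTime) (q : X × X) => (gauss b z : ℂ) *
      (character z (σ q.1 - σ q.2) * (F q.1 * (starRingEnd ℂ) (F q.2))))
      (volume.prod (ν.prod ν)) := by
    have h1 : Integrable (fun x : SpaceTime × X × X => (gauss b x.1 : ℂ) *
        (F x.2.1 * (starRingEnd ℂ) (F x.2.2))) (volume.prod (ν.prod ν)) :=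
      (integrable_gauss hb).ofReal.mul_prod hFF
    refine (h1.bdd_mul (c := 1) hchar.aestronglyMeasurable
      (Eventually.of_forall fun x => by simp)).congr (Eventually.of_forall fun x => ?_)
    simp only [Function.uncurry]
    ring
  have hUint : Integrable (fun z => gauss b z * ‖U z‖ ^ 2) := by
    have h1 := hint.integral_prod_left
    simp only [Function.uncurry] at h1
    simp_rw [← hU2] at h1
    refine h1.re.congr (Eventually.of_forall fun z => ?_)
    simp only [RCLike.re_eq_complex_re, Complex.ofReal_re]
  have hswap : ((∫ z, gauss b z * ‖U z‖ ^ 2 : ℝ) : ℂ) =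
      ∫ q : X × X, (Γ (σ q.1 - σ q.2) : ℂ) * (F q.1 * (starRingEnd ℂ) (F q.2)) ∂(ν.prod ν) := by
    rw [← integral_complex_ofReal, integral_congr_ae (Eventually.of_forall hU2),
      integral_integral_swap hint]
    refine integral_congr_ae (Eventually.of_forall fun q => ?_)
    simp only
    rw [← integral_gauss_mul_character hb, ← integral_mul_const]
    congr 1
    ext z
    ring
  have hlhs : ∫⁻ z, ENNReal.ofReal (gauss b z) * ‖U z‖ₑ ^ 2 =
      ‖((∫ z, gauss b z * ‖U z‖ ^ 2 : ℝ) : ℂ)‖ₑ := by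
    have hnn : 0 ≤ ∫ z, gauss b z * ‖U z‖ ^ 2 :=
      integral_nonneg fun z => mul_nonneg (gauss_nonneg _ _) (by positivity)
    rw [← ofReal_norm, Complex.norm_real, Real.norm_of_nonneg hnn,
      ofReal_integral_eq_lintegral_ofReal hUint
        (Eventually.of_forall fun z => mul_nonneg (gauss_nonneg _ _) (by positivity))]
    refine lintegral_congr fun z => ?_
    rw [ENNReal.ofReal_mul (gauss_nonneg _ _), ENNReal.ofReal_pow (norm_nonneg _),
      ofReal_norm]
  have hFm : AEMeasurable (fun p => ‖F p‖ₑ ^ 2) ν := hF.1.enorm.pow_const 2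
  set A := ∫⁻ p, ‖F p‖ₑ ^ 2 ∂ν with hA
  -- The density bound enters here, controlling one marginal of the kernel; evenness of `Γ` handles
  -- the other.
  have hkey : ∀ ζ, ∫⁻ p, ENNReal.ofReal (Γ (ζ - σ p)) ∂ν ≤
      C * ENNReal.ofReal (16 * Real.pi ^ 4) := by
    intro ζ
    refine (hC (fun z => ENNReal.ofReal (Γ (ζ - z))) (by fun_prop)).trans_eq ?_
    rw [lintegral_sub_left_eq_self (fun z => ENNReal.ofReal (Γ z)) ζ, hΓi]
  have hΓq : Measurable fun q : X × X => ENNReal.ofReal (Γ (σ q.1 - σ q.2)) := by fun_prop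
  have hT1 : ∫⁻ q : X × X, ‖F q.1‖ₑ ^ 2 * ENNReal.ofReal (Γ (σ q.1 - σ q.2)) ∂(ν.prod ν) ≤
      ENNReal.ofReal (16 * Real.pi ^ 4) * C * A := by
    refine (lintegral_prod _ (hFm.comp_fst.mul hΓq.aemeasurable)).trans_le ?_
    simp only [Pi.mul_apply]
    calc ∫⁻ p, ∫⁻ p', ‖F p‖ₑ ^ 2 * ENNReal.ofReal (Γ (σ p - σ p')) ∂ν ∂ν
        ≤ ∫⁻ p, ‖F p‖ₑ ^ 2 * (C * ENNReal.ofReal (16 * Real.pi ^ 4)) ∂ν := by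
          refine lintegral_mono fun p => ?_
          simp only
          rw [lintegral_const_mul _ (by fun_prop)]
          exact mul_le_mul' le_rfl (hkey _)
      _ = _ := by
          rw [lintegral_mul_const'' _ hFm]; ring
  have hT2 : ∫⁻ q : X × X, ‖F q.2‖ₑ ^ 2 * ENNReal.ofReal (Γ (σ q.1 - σ q.2)) ∂(ν.prod ν) ≤
      ENNReal.ofReal (16 * Real.pi ^ 4) * C * A := by
    rw [← lintegral_prod_swap]
    refine le_trans (le_of_eq ?_) hT1
    refine lintegral_congr fun q => ?_
    simp only [Prod.fst_swap, Prod.snd_swap]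
    rw [← neg_sub (σ q.1), hΓ]
    simp only [gauss_neg]
  rw [hlhs, hswap]
  refine (enorm_integral_le_lintegral_enorm _).trans ?_
  have hpt : ∀ q : X × X, ‖(Γ (σ q.1 - σ q.2) : ℂ) * (F q.1 * (starRingEnd ℂ) (F q.2))‖ₑ ≤
      2⁻¹ * (‖F q.1‖ₑ ^ 2 * ENNReal.ofReal (Γ (σ q.1 - σ q.2)) +
        ‖F q.2‖ₑ ^ 2 * ENNReal.ofReal (Γ (σ q.1 - σ q.2))) :=
    fun q => enorm_kernel_mul_le (hΓ0 _) _ _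
  refine (lintegral_mono hpt).trans ?_
  have hadd := lintegral_add_left' (μ := ν.prod ν) (hFm.comp_fst.mul hΓq.aemeasurable)
    (fun q : X × X => ‖F q.2‖ₑ ^ 2 * ENNReal.ofReal (Γ (σ q.1 - σ q.2)))
  simp only [Pi.mul_apply] at hadd
  rw [lintegral_const_mul' _ _ (by simp), hadd]
  refine (mul_le_mul' le_rfl (add_le_add hT1 hT2)).trans_eq ?_
  rw [← two_mul, ← mul_assoc, ENNReal.inv_mul_cancel (by simp) (by simp), one_mul]

/-- The `L²` norm of the Fourier transform of a measure `σ_*(F ν)` whose underlying positive measure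
`σ_* ν` has density at most `C`. -/
theorem lintegral_sq_oscillatory_le {X : Type*} [MeasurableSpace X] {ν : Measure X}
    [SFinite ν] {σ : X → SpaceTime} (hσ : Measurable σ) {C : ℝ≥0∞}
    (hC : ∀ h : SpaceTime → ℝ≥0∞, Measurable h → ∫⁻ p, h (σ p) ∂ν ≤ C * ∫⁻ z, h z)
    {F : X → ℂ} (hF : Integrable F ν) :
    ∫⁻ z, ‖∫ p, character z (σ p) * F p ∂ν‖ₑ ^ 2 ≤
      ENNReal.ofReal (16 * Real.pi ^ 4) * C * ∫⁻ p, ‖F p‖ₑ ^ 2 ∂ν := by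
  set U : SpaceTime → ℂ := fun z => ∫ p, character z (σ p) * F p ∂ν
  have hU : Measurable U := (continuous_oscillatory hσ hF).measurable
  have hlim : ∀ z, Tendsto (fun n : ℕ => ENNReal.ofReal (gauss (1 / ((n : ℝ) + 1)) z) * ‖U z‖ₑ ^ 2)
      atTop (𝓝 (‖U z‖ₑ ^ 2)) := by
    intro z
    have h1 : Tendsto (fun n : ℕ => gauss (1 / ((n : ℝ) + 1)) z) atTop (𝓝 (gauss 0 z)) := by
      have hc : Continuous fun b => gauss b z := by unfold gauss; fun_prop
      exact (hc.tendsto 0).comp tendsto_one_div_add_atTop_nhds_zero_nat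
    have h2 : gauss 0 z = 1 := by simp [gauss]
    rw [h2] at h1
    have h3 := ENNReal.Tendsto.mul_const (b := ‖U z‖ₑ ^ 2) (ENNReal.tendsto_ofReal h1)
      (Or.inl (by simp))
    simpa using h3
  calc ∫⁻ z, ‖U z‖ₑ ^ 2 = ∫⁻ z, liminf (fun n : ℕ =>
        ENNReal.ofReal (gauss (1 / ((n : ℝ) + 1)) z) * ‖U z‖ₑ ^ 2) atTop :=
        lintegral_congr fun z => (hlim z).liminf_eq.symm
    -- Fatou's lemma as the damping parameter `1 / (n + 1)` tends to zero.
    _ ≤ liminf (fun n : ℕ => ∫⁻ z,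
        ENNReal.ofReal (gauss (1 / ((n : ℝ) + 1)) z) * ‖U z‖ₑ ^ 2) atTop :=
        lintegral_liminf_le fun n =>
          ((continuous_gauss _).measurable.ennreal_ofReal).mul (hU.enorm.pow_const 2)
    _ ≤ _ := by
        refine liminf_le_of_le (by isBoundedDefault) fun c hc => ?_
        obtain ⟨n, hn⟩ := hc.exists
        exact hn.trans (lintegral_sq_oscillatory_gauss_le hσ hC hF (by positivity))

/-! ### Bilinear and linear extension estimates on the upper sheet -/

theorem ennreal_sum_pow_le {ι : Type*} (s : Finset ι) (f : ι → ℝ≥0∞) (n : ℕ) :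
    (∑ i ∈ s, f i) ^ (n + 1) ≤ (s.card : ℝ≥0∞) ^ n * ∑ i ∈ s, f i ^ (n + 1) := by
  have h := ENNReal.rpow_sum_le_const_mul_sum_rpow s f (p := ((n + 1 : ℕ) : ℝ))
    (by push_cast; linarith [Nat.cast_nonneg (α := ℝ) n])
  have h1 : (((n + 1 : ℕ) : ℝ) - 1) = (n : ℝ) := by push_cast; ring
  rw [h1] at h
  simpa only [ENNReal.rpow_natCast] using h

theorem ennreal_add_pow_le (a b : ℝ≥0∞) (n : ℕ) :
    (a + b) ^ (n + 1) ≤ 2 ^ n * (a ^ (n + 1) + b ^ (n + 1)) := by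
  simpa [Fin.sum_univ_two] using ennreal_sum_pow_le Finset.univ ![a, b] n

/-- The point of the upper sheet over `y`. -/
noncomputable def sheetPoint (y : Space) : SpaceTime := (y, height y)

theorem measurable_sheetPoint : Measurable sheetPoint := measurable_id.prodMk measurable_height

/-- The extension operator of the upper sheet. -/
noncomputable def sheetExt (g : Space → ℂ) (z : SpaceTime) : ℂ :=
  ∫ y, character z (sheetPoint y) * g y ∂weight

theorem continuous_sheetExt {g : Space → ℂ} (hg : Integrable g weight) :
    Continuous (sheetExt g) :=
  continuous_oscillatory measurable_sheetPoint hg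

/-- A product of characters is the character at the sum of the frequencies, which turns the bilinear
`L²` problem into a density bound for the sum map. -/
theorem sheetExt_mul_sheetExt (f g : Space → ℂ) (z : SpaceTime) :
    sheetExt f z * sheetExt g z =
      ∫ p : Space × Space, character z (sheetSum p) * (f p.1 * g p.2) ∂(weight.prod weight) := by
  unfold sheetExt
  rw [← integral_prod_mul]
  congr 1
  ext p
  have : sheetSum p = sheetPoint p.1 + sheetPoint p.2 := rfl
  rw [this, character_add]
  ring

/-- The bilinear extension estimate for the upper sheet. -/
theorem lintegral_sheetExt_mul_le {f g : Space → ℂ} (hf : Integrable f weight)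
    (hg : Integrable g weight) {κ : ℝ} (hκ : 0 ≤ κ)
    (hfg : ∀ y y', f y ≠ 0 → g y' ≠ 0 → min ‖y‖ ‖y'‖ ≤ κ * ‖y + y'‖) :
    ∫⁻ z, ‖sheetExt f z * sheetExt g z‖ₑ ^ 2 ≤
      ENNReal.ofReal (64 * Real.pi ^ 5 * κ) *
        ((∫⁻ y, ‖f y‖ₑ ^ 2 ∂weight) * ∫⁻ y, ‖g y‖ₑ ^ 2 ∂weight) := by
  set S : Set (Space × Space) := {p | min ‖p.1‖ ‖p.2‖ ≤ κ * ‖p.1 + p.2‖} with hS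
  have h1 : ∀ z, sheetExt f z * sheetExt g z =
      ∫ p in S, character z (sheetSum p) * (f p.1 * g p.2) ∂(weight.prod weight) := by
    -- The support hypothesis makes the amplitude vanish off `S`, so restricting the measure loses
    -- nothing.
    intro z
    rw [sheetExt_mul_sheetExt, setIntegral_eq_integral_of_forall_compl_eq_zero]
    intro p hp
    by_contra hne
    simp only [mul_eq_zero, not_or] at hne
    exact hp (hfg _ _ hne.2.1 hne.2.2)
  simp_rw [h1]
  refine (lintegral_sq_oscillatory_le (ν := (weight.prod weight).restrict S) measurable_sheetSum
    (fun h hh => lintegral_comp_sheetSum_le_of_min hh hκ) (hf.mul_prod hg).restrict).trans ?_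
  rw [← ENNReal.ofReal_mul (by positivity),
    show 16 * Real.pi ^ 4 * (4 * Real.pi * κ) = 64 * Real.pi ^ 5 * κ by ring]
  refine mul_le_mul' le_rfl ((setLIntegral_le_lintegral _ _).trans_eq ?_)
  rw [← lintegral_prod_mul (hf.1.enorm.pow_const 2) (hg.1.enorm.pow_const 2)]
  refine lintegral_congr fun p => ?_
  rw [enorm_mul, mul_pow]

/-- The part of `f` over the octant of `ℝ³` with sign pattern `j`. -/
noncomputable def octantPart (j : Fin 3 → Bool) (f : Space → ℂ) (y : Space) : ℂ :=
  if (fun i => decide (0 ≤ y i)) = j then f y else 0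

theorem sum_octantPart (f : Space → ℂ) (y : Space) : ∑ j, octantPart j f y = f y := by
  simp [octantPart]

/-- Coordinates of equal sign cannot cancel. Hence within one octant the bilinear estimate applies
with `κ = 1`. -/
theorem norm_le_norm_add_of_octant {y y' : Space}
    (h : (fun i => decide (0 ≤ y i)) = fun i => decide (0 ≤ y' i)) : ‖y‖ ≤ ‖y + y'‖ := by
  rw [← sq_le_sq₀ (norm_nonneg _) (norm_nonneg _), EuclideanSpace.norm_sq_eq,
    EuclideanSpace.norm_sq_eq]
  refine Finset.sum_le_sum fun i _ => ?_
  have hi := congrFun h i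
  simp only [decide_eq_decide] at hi
  simp only [Real.norm_eq_abs, sq_abs, PiLp.add_apply]
  by_cases h0 : 0 ≤ y i
  · nlinarith [hi.1 h0]
  · have h1 : ¬ 0 ≤ y' i := fun h => h0 (hi.2 h)
    push Not at h0 h1
    nlinarith

theorem integrable_octantPart (j : Fin 3 → Bool) {f : Space → ℂ} (hf : Integrable f weight) :
    Integrable (octantPart j f) weight := by
  have hs : MeasurableSet {y : Space | (fun i => decide (0 ≤ y i)) = j} := by
    have : {y : Space | (fun i => decide (0 ≤ y i)) = j} =
        ⋂ i, {y : Space | 0 ≤ y i ↔ j i = true} := by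
      ext y
      simp only [Set.mem_ofPred_eq, Set.mem_iInter, funext_iff]
      refine forall_congr' fun i => ?_
      cases j i <;> simp
    rw [this]
    refine MeasurableSet.iInter fun i => ?_
    have h0 : MeasurableSet {y : Space | 0 ≤ y i} := measurableSet_le (by fun_prop) (by fun_prop)
    cases j i
    · convert h0.compl using 1
      ext y; simp
    · simpa using h0
  refine (hf.indicator hs).congr (Eventually.of_forall fun y => ?_)
  simp [octantPart, Set.indicator_apply]

theorem enorm_octantPart_le (j : Fin 3 → Bool) (f : Space → ℂ) (y : Space) :
    ‖octantPart j f y‖ₑ ≤ ‖f y‖ₑ := by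
  unfold octantPart; split_ifs <;> simp

/-- The extension estimate from `L²` to `L⁴` for the upper sheet. -/
theorem lintegral_sheetExt_pow_le {f : Space → ℂ} (hf : Integrable f weight) :
    ∫⁻ z, ‖sheetExt f z‖ₑ ^ 4 ≤
      8 ^ 4 * ENNReal.ofReal (64 * Real.pi ^ 5) * (∫⁻ y, ‖f y‖ₑ ^ 2 ∂weight) ^ 2 := by
  have hsum : ∀ z, sheetExt f z = ∑ j, sheetExt (octantPart j f) z := by
    intro z
    unfold sheetExt
    rw [← integral_finsetSum _ fun j _ =>
      integrable_character_mul measurable_sheetPoint (integrable_octantPart j hf) z]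
    congr 1
    ext y
    rw [← Finset.mul_sum, sum_octantPart]
  have hj : ∀ j, ∫⁻ z, ‖sheetExt (octantPart j f) z‖ₑ ^ 4 ≤
      ENNReal.ofReal (64 * Real.pi ^ 5) * (∫⁻ y, ‖f y‖ₑ ^ 2 ∂weight) ^ 2 := by
    intro j
    have h1 := lintegral_sheetExt_mul_le (integrable_octantPart j hf) (integrable_octantPart j hf)
      zero_le_one (fun y y' hy hy' => by
        have hyj : (fun i => decide (0 ≤ y i)) = j := by
          by_contra h; simp [octantPart, h] at hy
        have hyj' : (fun i => decide (0 ≤ y' i)) = j := by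
          by_contra h; simp [octantPart, h] at hy'
        rw [one_mul]
        exact (min_le_left _ _).trans (norm_le_norm_add_of_octant (hyj.trans hyj'.symm)))
    have h2 : ∫⁻ y, ‖octantPart j f y‖ₑ ^ 2 ∂weight ≤ ∫⁻ y, ‖f y‖ₑ ^ 2 ∂weight :=
      lintegral_mono fun y => pow_le_pow_left' (enorm_octantPart_le j f y) 2
    calc ∫⁻ z, ‖sheetExt (octantPart j f) z‖ₑ ^ 4
        = ∫⁻ z, ‖sheetExt (octantPart j f) z * sheetExt (octantPart j f) z‖ₑ ^ 2 := by
          refine lintegral_congr fun z => ?_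
          rw [enorm_mul]; ring
      _ ≤ _ := h1
      _ ≤ _ := by
          rw [mul_one, sq]
          gcongr
  calc ∫⁻ z, ‖sheetExt f z‖ₑ ^ 4
      ≤ ∫⁻ z, 8 ^ 3 * ∑ j, ‖sheetExt (octantPart j f) z‖ₑ ^ 4 := by
        refine lintegral_mono fun z => ?_
        simp only
        rw [hsum]
        refine (pow_le_pow_left' (enorm_sum_le _ _) 4).trans ?_
        simpa using ennreal_sum_pow_le Finset.univ (fun j => ‖sheetExt (octantPart j f) z‖ₑ) 3
    _ = 8 ^ 3 * ∑ j, ∫⁻ z, ‖sheetExt (octantPart j f) z‖ₑ ^ 4 := by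
        rw [lintegral_const_mul' _ _ (by simp), lintegral_finsetSum]
        exact fun j _ =>
          (continuous_sheetExt (integrable_octantPart j hf)).measurable.enorm.pow_const 4
    _ ≤ 8 ^ 3 * ∑ _j : Fin 3 → Bool,
          ENNReal.ofReal (64 * Real.pi ^ 5) * (∫⁻ y, ‖f y‖ₑ ^ 2 ∂weight) ^ 2 := by
        gcongr with j
        exact hj j
    _ = _ := by
        simp
        ring

/-! ### The two sheets together -/

theorem measurePreserving_neg_weight :
    MeasurePreserving (fun y : Space => -y) weight weight := by
  refine ⟨measurable_neg, ?_⟩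
  ext s hs
  rw [Measure.map_apply measurable_neg hs, ← lintegral_indicator_one hs,
    ← lintegral_indicator_one (measurable_neg hs), lintegral_weight (measurable_one.indicator hs),
    lintegral_weight (measurable_one.indicator (measurable_neg hs)),
    ← lintegral_neg_eq_self (fun y : Space => ENNReal.ofReal (height y)⁻¹ * s.indicator 1 y)]
  refine lintegral_congr fun y => ?_
  rw [height_neg]
  rfl

theorem measurePreserving_sheetPoint : MeasurePreserving sheetPoint weight muPlus :=
  ⟨measurable_sheetPoint, rfl⟩

/-- The height is even, so `(y, -height y)` is the negative of the upper point over `-y`. -/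
theorem measurePreserving_neg_sheetPoint :
    MeasurePreserving (fun y => -sheetPoint y) weight muMinus := by
  have h : MeasurePreserving (fun y : Space => ((y, -height y) : SpaceTime)) weight muMinus :=
    ⟨measurable_id.prodMk measurable_height.neg, rfl⟩
  have h2 := h.comp measurePreserving_neg_weight
  convert h2 using 2 with y
  ext y <;> simp [sheetPoint, height_neg]

/-- The part of `f` on the upper sheet. -/
noncomputable def upperPart (f : SpaceTime → ℂ) (y : Space) : ℂ := f (sheetPoint y)

/-- The part of `f` on the lower sheet, reflected to the upper sheet and conjugated. -/
noncomputable def lowerPart (f : SpaceTime → ℂ) (y : Space) : ℂ :=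
  (starRingEnd ℂ) (f (-sheetPoint y))

theorem muPlus_le : muPlus ≤ muBar := Measure.le_add_right le_rfl

theorem muMinus_le : muMinus ≤ muBar := Measure.le_add_left le_rfl

theorem integrable_upperPart {f : SpaceTime → ℂ} (hf : Integrable f muBar) :
    Integrable (upperPart f) weight :=
  measurePreserving_sheetPoint.integrable_comp_of_integrable (hf.mono_measure muPlus_le)

theorem integrable_lowerPart {f : SpaceTime → ℂ} (hf : Integrable f muBar) :
    Integrable (lowerPart f) weight := by
  have h := measurePreserving_neg_sheetPoint.integrable_comp_of_integrable
    (hf.mono_measure muMinus_le)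
  exact h.mono (Complex.continuous_conj.comp_aestronglyMeasurable h.1)
    (Eventually.of_forall fun p => by simp [lowerPart])

theorem lintegral_muBar {h : SpaceTime → ℝ≥0∞} (hh : AEMeasurable h muBar) :
    ∫⁻ ξ, h ξ ∂muBar = ∫⁻ y, h (sheetPoint y) ∂weight + ∫⁻ y, h (-sheetPoint y) ∂weight := by
  unfold muBar
  rw [lintegral_add_measure, ← measurePreserving_sheetPoint.map_eq,
    ← measurePreserving_neg_sheetPoint.map_eq, lintegral_map', lintegral_map']
  · rw [measurePreserving_neg_sheetPoint.map_eq]; exact hh.mono_measure muMinus_le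
  · exact measurePreserving_neg_sheetPoint.measurable.aemeasurable
  · rw [measurePreserving_sheetPoint.map_eq]; exact hh.mono_measure muPlus_le
  · exact measurePreserving_sheetPoint.measurable.aemeasurable

theorem lintegral_upperPart_add_lowerPart {f : SpaceTime → ℂ} (hf : AEStronglyMeasurable f muBar) :
    (∫⁻ y, ‖upperPart f y‖ₑ ^ 2 ∂weight) + ∫⁻ y, ‖lowerPart f y‖ₑ ^ 2 ∂weight =
      ∫⁻ ξ, ‖f ξ‖ₑ ^ 2 ∂muBar := by
  rw [lintegral_muBar (hf.enorm.pow_const 2)]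
  simp [upperPart, lowerPart]

/-- The extension operator of the hyperboloid, on integrable functions. -/
noncomputable def integralExt (f : SpaceTime → ℂ) (z : SpaceTime) : ℂ :=
  ∫ ξ, character z ξ * f ξ ∂muBar

theorem continuous_integralExt {f : SpaceTime → ℂ} (hf : Integrable f muBar) :
    Continuous (integralExt f) :=
  continuous_oscillatory measurable_id hf

/-- Negating a frequency conjugates its character; the conjugation built into `lowerPart` makes the
lower contribution the conjugate of an upper-sheet extension. -/
theorem integralExt_eq {f : SpaceTime → ℂ} (hf : Integrable f muBar) (z : SpaceTime) :
    integralExt f z =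
      sheetExt (upperPart f) z + (starRingEnd ℂ) (sheetExt (lowerPart f) z) := by
  have hi := integrable_character_mul measurable_id hf z
  simp only [id_eq] at hi
  unfold integralExt sheetExt muBar
  rw [integral_add_measure (hi.mono_measure muPlus_le) (hi.mono_measure muMinus_le),
    ← integral_conj]
  congr 1
  · rw [← measurePreserving_sheetPoint.map_eq, integral_map]
    · rfl
    · exact measurePreserving_sheetPoint.measurable.aemeasurable
    · rw [measurePreserving_sheetPoint.map_eq]; exact (hi.mono_measure muPlus_le).1
  · rw [← measurePreserving_neg_sheetPoint.map_eq, integral_map]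
    · congr 1
      ext y
      simp [lowerPart, conj_character]
    · exact measurePreserving_neg_sheetPoint.measurable.aemeasurable
    · rw [measurePreserving_neg_sheetPoint.map_eq]; exact (hi.mono_measure muMinus_le).1

theorem enorm_conj (a : ℂ) : ‖(starRingEnd ℂ) a‖ₑ = ‖a‖ₑ := by
  rw [← ofReal_norm, ← ofReal_norm, RCLike.norm_conj]

/-- The constant in the extension estimate. -/
noncomputable def extConst : ℝ≥0∞ := 8 * (8 ^ 4 * ENNReal.ofReal (64 * Real.pi ^ 5))

theorem extConst_ne_top : extConst ≠ ∞ := by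
  unfold extConst
  exact ENNReal.mul_ne_top (by simp) (ENNReal.mul_ne_top (by simp) ENNReal.ofReal_ne_top)

theorem lintegral_integralExt_pow_le {f : SpaceTime → ℂ} (hf : Integrable f muBar) :
    ∫⁻ z, ‖integralExt f z‖ₑ ^ 4 ≤ extConst * (∫⁻ ξ, ‖f ξ‖ₑ ^ 2 ∂muBar) ^ 2 := by
  rw [← lintegral_upperPart_add_lowerPart hf.1]
  set A := ∫⁻ y, ‖upperPart f y‖ₑ ^ 2 ∂weight
  set B := ∫⁻ y, ‖lowerPart f y‖ₑ ^ 2 ∂weight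
  set K := 8 ^ 4 * ENNReal.ofReal (64 * Real.pi ^ 5) with hK
  calc ∫⁻ z, ‖integralExt f z‖ₑ ^ 4
      ≤ ∫⁻ z, 2 ^ 3 * (‖sheetExt (upperPart f) z‖ₑ ^ 4 + ‖sheetExt (lowerPart f) z‖ₑ ^ 4) := by
        refine lintegral_mono fun z => ?_
        simp only
        rw [integralExt_eq hf]
        refine (pow_le_pow_left' (enorm_add_le _ _) 4).trans ?_
        rw [enorm_conj]
        exact ennreal_add_pow_le _ _ 3
    _ = 2 ^ 3 * ((∫⁻ z, ‖sheetExt (upperPart f) z‖ₑ ^ 4) +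
          ∫⁻ z, ‖sheetExt (lowerPart f) z‖ₑ ^ 4) := by
        rw [lintegral_const_mul' _ _ (by simp), lintegral_add_left]
        exact (continuous_sheetExt (integrable_upperPart hf)).measurable.enorm.pow_const 4
    _ ≤ 2 ^ 3 * (K * A ^ 2 + K * B ^ 2) :=
        mul_le_mul' le_rfl (add_le_add (lintegral_sheetExt_pow_le (integrable_upperPart hf))
          (lintegral_sheetExt_pow_le (integrable_lowerPart hf)))
    _ ≤ extConst * (A + B) ^ 2 := by
        have h8 : (2 : ℝ≥0∞) ^ 3 = 8 := by norm_num
        have hAB : A ^ 2 + B ^ 2 ≤ (A + B) ^ 2 := by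
          rw [add_sq]
          gcongr
          exact le_self_add
        unfold extConst
        rw [h8, ← mul_add, ← mul_assoc]
        exact mul_le_mul' le_rfl hAB

/-- Moduli ignore conjugation, so each of the four sheet pairings reduces to the upper sheet.
Reflecting a lower point changes its sign, hence mixed pairings need the condition on the difference
and equal ones that on the sum. -/
theorem lintegral_integralExt_mul_le {f g : SpaceTime → ℂ} (hf : Integrable f muBar)
    (hg : Integrable g muBar) {κ : ℝ} (hκ : 0 ≤ κ)
    (hfg : ∀ ξ η, f ξ ≠ 0 → g η ≠ 0 →
      min ‖ξ.1‖ ‖η.1‖ ≤ κ * ‖ξ.1 + η.1‖ ∧ min ‖ξ.1‖ ‖η.1‖ ≤ κ * ‖ξ.1 - η.1‖) :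
    ∫⁻ z, ‖integralExt f z * integralExt g z‖ₑ ^ 2 ≤
      4 * ENNReal.ofReal (64 * Real.pi ^ 5 * κ) *
        ((∫⁻ ξ, ‖f ξ‖ₑ ^ 2 ∂muBar) * ∫⁻ ξ, ‖g ξ‖ₑ ^ 2 ∂muBar) := by
  rw [← lintegral_upperPart_add_lowerPart hf.1, ← lintegral_upperPart_add_lowerPart hg.1]
  have hfu := integrable_upperPart hf
  have hfl := integrable_lowerPart hf
  have hgu := integrable_upperPart hg
  have hgl := integrable_lowerPart hg
  have hm : ∀ {u v : Space → ℂ}, Integrable u weight → Integrable v weight →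
      Measurable fun z => ‖sheetExt u z * sheetExt v z‖ₑ ^ 2 := fun hu hv =>
    ((continuous_sheetExt hu).mul (continuous_sheetExt hv)).measurable.enorm.pow_const 2
  have huu := lintegral_sheetExt_mul_le hfu hgu hκ
    (fun y y' hy hy' => (hfg _ _ hy hy').1)
  have hul := lintegral_sheetExt_mul_le hfu hgl hκ (fun y y' hy hy' => by
    have := (hfg (sheetPoint y) (-sheetPoint y') hy (by simpa [lowerPart] using hy')).2
    simpa [sheetPoint] using this)
  have hlu := lintegral_sheetExt_mul_le hfl hgu hκ (fun y y' hy hy' => by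
    have := (hfg (-sheetPoint y) (sheetPoint y') (by simpa [lowerPart] using hy) hy').2
    rw [← norm_neg (_ - _)] at this
    simpa [sheetPoint, add_comm] using this)
  have hll := lintegral_sheetExt_mul_le hfl hgl hκ (fun y y' hy hy' => by
    have := (hfg (-sheetPoint y) (-sheetPoint y') (by simpa [lowerPart] using hy)
      (by simpa [lowerPart] using hy')).1
    rw [← norm_neg (_ + _)] at this
    simpa [sheetPoint, add_comm] using this)
  calc ∫⁻ z, ‖integralExt f z * integralExt g z‖ₑ ^ 2
      ≤ ∫⁻ z, 4 * (‖sheetExt (upperPart f) z * sheetExt (upperPart g) z‖ₑ ^ 2 +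
          (‖sheetExt (upperPart f) z * sheetExt (lowerPart g) z‖ₑ ^ 2 +
          (‖sheetExt (lowerPart f) z * sheetExt (upperPart g) z‖ₑ ^ 2 +
          ‖sheetExt (lowerPart f) z * sheetExt (lowerPart g) z‖ₑ ^ 2))) := by
        refine lintegral_mono fun z => ?_
        simp only
        rw [integralExt_eq hf, integralExt_eq hg, enorm_mul, mul_pow]
        have h1 := fun a b : ℂ => (pow_le_pow_left' (enorm_add_le a ((starRingEnd ℂ) b)) 2).trans
          (ennreal_add_pow_le ‖a‖ₑ ‖(starRingEnd ℂ) b‖ₑ 1)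
        refine (mul_le_mul' (h1 _ _) (h1 _ _)).trans_eq ?_
        simp only [enorm_conj, enorm_mul]
        ring
    _ = 4 * ((∫⁻ z, ‖sheetExt (upperPart f) z * sheetExt (upperPart g) z‖ₑ ^ 2) +
          ((∫⁻ z, ‖sheetExt (upperPart f) z * sheetExt (lowerPart g) z‖ₑ ^ 2) +
          ((∫⁻ z, ‖sheetExt (lowerPart f) z * sheetExt (upperPart g) z‖ₑ ^ 2) +
          ∫⁻ z, ‖sheetExt (lowerPart f) z * sheetExt (lowerPart g) z‖ₑ ^ 2))) := by
        rw [lintegral_const_mul' _ _ (by simp), lintegral_add_left (hm hfu hgu),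
          lintegral_add_left (hm hfu hgl), lintegral_add_left (hm hfl hgu)]
    _ ≤ _ := by
        refine (mul_le_mul' le_rfl (add_le_add huu (add_le_add hul
          (add_le_add hlu hll)))).trans_eq ?_
        ring

/-! ### Extension of all `L²` functions by truncation and duality -/

theorem eLpNorm_pow_natCast {X E : Type*} [MeasurableSpace X] [NormedAddCommGroup E] (f : X → E)
    (μ : Measure X) {n : ℕ} (hn : n ≠ 0) : eLpNorm f n μ ^ n = ∫⁻ x, ‖f x‖ₑ ^ n ∂μ := by
  have h := eLpNorm_nnreal_pow_eq_lintegral (f := f) (μ := μ) (p := (n : NNReal))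
    (by exact_mod_cast hn)
  simpa using h

theorem eLpNorm_two_sq {X E : Type*} [MeasurableSpace X] [NormedAddCommGroup E] (f : X → E)
    (μ : Measure X) : eLpNorm f 2 μ ^ 2 = ∫⁻ x, ‖f x‖ₑ ^ 2 ∂μ := by
  simpa using eLpNorm_pow_natCast f μ two_ne_zero

theorem eLpNorm_four_pow {X E : Type*} [MeasurableSpace X] [NormedAddCommGroup E] (f : X → E)
    (μ : Measure X) : eLpNorm f 4 μ ^ 4 = ∫⁻ x, ‖f x‖ₑ ^ 4 ∂μ := by
  simpa using eLpNorm_pow_natCast f μ four_ne_zero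

/-- The slab of points of space-time whose spatial part has norm at most `r`. -/
def slab (r : ℝ) : Set SpaceTime := {ξ | ‖ξ.1‖ ≤ r}

theorem measurableSet_slab (r : ℝ) : MeasurableSet (slab r) :=
  measurableSet_le (by fun_prop) measurable_const

theorem eventually_mem_slab (ξ : SpaceTime) : ∀ᶠ n : ℕ in atTop, ξ ∈ slab n :=
  (eventually_ge_atTop ⌈‖ξ.1‖⌉₊).mono fun _ hn => (Nat.le_ceil ‖ξ.1‖).trans (Nat.cast_le.2 hn)

theorem muBar_slab (r : ℝ) :
    muBar (slab r) = weight {y | ‖y‖ ≤ r} + weight {y | ‖y‖ ≤ r} := by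
  have hs : MeasurableSet {y : Space | ‖y‖ ≤ r} := measurableSet_le measurable_norm measurable_const
  rw [← lintegral_indicator_one (measurableSet_slab r), lintegral_muBar
    (measurable_one.indicator (measurableSet_slab r)).aemeasurable, ← lintegral_indicator_one hs]
  congr 1
  all_goals
    refine lintegral_congr fun y => ?_
    simp [Set.indicator_apply, slab, sheetPoint]

theorem muBar_slab_lt_top (r : ℝ) : muBar (slab r) < ∞ := by
  rw [muBar_slab]
  exact ENNReal.add_lt_top.2 ⟨weight_closedBall_lt_top r, weight_closedBall_lt_top r⟩

instance : SFinite muPlus := by unfold muPlus; infer_instance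

instance : SFinite muMinus := by unfold muMinus; infer_instance

instance : SFinite muBar := by unfold muBar; infer_instance

theorem integrable_indicator_slab {f : SpaceTime → ℂ} (hf : MemLp f 2 muBar) (r : ℝ) :
    Integrable ((slab r).indicator f) muBar := by
  rw [integrable_indicator_iff (measurableSet_slab r)]
  have : IsFiniteMeasure (muBar.restrict (slab r)) :=
    ⟨by rw [Measure.restrict_apply_univ]; exact muBar_slab_lt_top r⟩
  exact memLp_one_iff_integrable.1 ((hf.restrict _).mono_exponent (by norm_num))

theorem integrable_of_support_subset_slab {f : SpaceTime → ℂ} (hf : MemLp f 2 muBar) {r : ℝ}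
    (h : ∀ ξ, f ξ ≠ 0 → ‖ξ.1‖ ≤ r) : Integrable f muBar := by
  have h1 := integrable_indicator_slab hf r
  have hs : Function.support f ⊆ slab r := fun ξ hξ => h ξ hξ
  rwa [Set.indicator_eq_self.2 hs] at h1

theorem tendsto_eLpNorm_indicator_slab {f : SpaceTime → ℂ} (hf : MemLp f 2 muBar) :
    Tendsto (fun n : ℕ => eLpNorm ((slab n).indicator f - f) 2 muBar) atTop (𝓝 0) := by
  have h1 : Tendsto (fun n : ℕ => ∫⁻ ξ, ‖((slab n).indicator f - f) ξ‖ₑ ^ 2 ∂muBar) atTop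
      (𝓝 (∫⁻ _, 0 ∂muBar)) := by
    refine tendsto_lintegral_of_dominated_convergence' (fun ξ => ‖f ξ‖ₑ ^ 2)
      (fun n => ((hf.1.indicator (measurableSet_slab n)).sub hf.1).enorm.pow_const 2)
      (fun n => Eventually.of_forall fun ξ => ?_) ?_ (Eventually.of_forall fun ξ => ?_)
    · by_cases h : ξ ∈ slab n <;> simp [h]
    · rw [← eLpNorm_two_sq]
      exact ENNReal.pow_ne_top hf.2.ne
    · refine tendsto_const_nhds.congr' ?_
      filter_upwards [eventually_mem_slab ξ] with n h
      simp [h]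
  simp_rw [← eLpNorm_two_sq, lintegral_zero] at h1
  have h2 := h1.ennrpow_const (1 / 2)
  have h3 : ∀ x : ℝ≥0∞, (x ^ 2) ^ (1 / 2 : ℝ) = x := fun x => by
    rw [← ENNReal.rpow_natCast, ← ENNReal.rpow_mul]; norm_num
  simp_rw [h3] at h2
  rwa [ENNReal.zero_rpow_of_pos (by norm_num)] at h2

theorem eLpNorm_integralExt_le {f : SpaceTime → ℂ} (hf : Integrable f muBar) :
    eLpNorm (integralExt f) 4 volume ≤ (extConst + 1) * eLpNorm f 2 muBar := by
  have h1 := lintegral_integralExt_pow_le hf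
  rw [← eLpNorm_four_pow, ← eLpNorm_two_sq, ← pow_mul] at h1
  -- The added `1` makes the constant dominated by its own fourth power and avoids taking a root.
  have h2 : extConst ≤ (extConst + 1) ^ 4 :=
    le_self_add.trans (le_self_pow₀ (by simp) (by norm_num))
  refine (ENNReal.pow_le_pow_left_iff (n := 4) (by norm_num)).1 ?_
  rw [mul_pow]
  exact h1.trans (mul_le_mul' h2 le_rfl)

theorem extConst_add_one_ne_top : extConst + 1 ≠ ∞ := by simp [extConst_ne_top]

theorem memLp_integralExt {f : SpaceTime → ℂ} (hf : Integrable f muBar) (hf2 : MemLp f 2 muBar) :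
    MemLp (integralExt f) 4 volume :=
  ⟨(continuous_integralExt hf).aestronglyMeasurable,
    (eLpNorm_integralExt_le hf).trans_lt (ENNReal.mul_lt_top extConst_add_one_ne_top.lt_top hf2.2)⟩

/-- The reflected Fourier transform of a test function. -/
noncomputable def testHat (φ : SchwartzMap SpaceTime ℂ) (ξ : SpaceTime) : ℂ :=
  ∫ z, character z ξ * φ z

theorem character_comm (z ξ : SpaceTime) : character z ξ = character ξ z := by
  unfold character
  rw [real_inner_comm, mul_comm z.2]

theorem continuous_testHat (φ : SchwartzMap SpaceTime ℂ) : Continuous (testHat φ) := by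
  unfold testHat
  simp_rw [fun ξ z => character_comm z ξ]
  exact continuous_oscillatory measurable_id (SchwartzMap.integrable φ)

theorem isExtension_integralExt {f : SpaceTime → ℂ} (hf : Integrable f muBar) :
    IsExtension f (integralExt f) := by
  intro φ
  have hφ : Integrable (φ : SpaceTime → ℂ) volume := SchwartzMap.integrable φ
  have hint : Integrable (Function.uncurry fun (z ξ : SpaceTime) =>
      character z ξ * (φ z * f ξ)) (volume.prod muBar) :=
    (hφ.mul_prod hf).bdd_mul (c := 1) measurable_character.aestronglyMeasurable
      (Eventually.of_forall fun x => by simp)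
  have h1 : ∀ z, integralExt f z * φ z = ∫ ξ, character z ξ * (φ z * f ξ) ∂muBar := by
    intro z
    unfold integralExt
    rw [← integral_mul_const]
    congr 1; ext ξ; ring
  simp_rw [h1]
  rw [integral_integral_swap hint]
  congr 1
  ext ξ
  rw [← integral_const_mul]
  congr 1; ext z; ring

instance : (4 : ℝ≥0∞).HolderConjugate (ENNReal.ofReal (4 / 3)) := by
  have h : (4 : ℝ).HolderConjugate (4 / 3) := by
    rw [Real.holderConjugate_iff]; norm_num
  simpa using h.ennrealOfReal

theorem enorm_integral_mul_le {X : Type*} [MeasurableSpace X] {μ : Measure X} {p q : ℝ≥0∞}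
    [p.HolderConjugate q] {f g : X → ℂ} (hf : AEStronglyMeasurable f μ)
    (hg : AEStronglyMeasurable g μ) :
    ‖∫ x, f x * g x ∂μ‖ₑ ≤ eLpNorm f p μ * eLpNorm g q μ := by
  refine (enorm_integral_le_lintegral_enorm _).trans ?_
  rw [← eLpNorm_one_eq_lintegral_enorm]
  have h : eLpNorm (f • g) 1 μ ≤ eLpNorm f p μ * eLpNorm g q μ :=
    eLpNorm_smul_le_mul_eLpNorm hg hf
  exact h

theorem tendsto_integral_mul {X : Type*} [MeasurableSpace X] {μ : Measure X} {p q : ℝ≥0∞}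
    [p.HolderConjugate q] {F : ℕ → X → ℂ} {f g : X → ℂ} (hF : ∀ n, MemLp (F n) p μ)
    (hf : MemLp f p μ) (hg : MemLp g q μ)
    (h : Tendsto (fun n => eLpNorm (F n - f) p μ) atTop (𝓝 0)) :
    Tendsto (fun n => ∫ x, F n x * g x ∂μ) atTop (𝓝 (∫ x, f x * g x ∂μ)) := by
  rw [tendsto_iff_edist_tendsto_0]
  have h1 : Tendsto (fun n => eLpNorm (F n - f) p μ * eLpNorm g q μ) atTop (𝓝 0) := by
    simpa using ENNReal.Tendsto.mul_const h (Or.inr hg.2.ne)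
  refine tendsto_of_tendsto_of_tendsto_of_le_of_le tendsto_const_nhds h1 (fun _ => bot_le)
    fun n => ?_
  have hi1 : Integrable (fun x => F n x * g x) μ := (hF n).integrable_mul hg
  have hi2 : Integrable (fun x => f x * g x) μ := hf.integrable_mul hg
  simp only
  rw [edist_eq_enorm_sub, ← integral_sub hi1 hi2]
  simp_rw [← sub_mul]
  exact enorm_integral_mul_le ((hF n).1.sub hf.1) hg.1

/-- The dual form of the extension estimate: testing against its own truncated conjugate `g` gives
`‖g‖² ≤ M ‖g‖`. This makes the right side of `IsExtension` continuous in `f ∈ L²`. -/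
theorem memLp_testHat (φ : SchwartzMap SpaceTime ℂ) : MemLp (testHat φ) 2 muBar := by
  have hc := continuous_testHat φ
  refine ⟨hc.aestronglyMeasurable, ?_⟩
  set M := (extConst + 1) * eLpNorm φ (ENNReal.ofReal (4 / 3)) volume with hM
  have hMtop : M < ∞ := ENNReal.mul_lt_top extConst_add_one_ne_top.lt_top
    (SchwartzMap.memLp φ _ volume).2
  have hbd : ∀ n : ℕ, eLpNorm ((slab n).indicator (testHat φ)) 2 muBar ≤ M := by
    intro n
    set g : SpaceTime → ℂ := (slab n).indicator fun ξ => (starRingEnd ℂ) (testHat φ ξ) with hg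
    have hgn : ∀ ξ, ‖g ξ‖ = ‖(slab n).indicator (testHat φ) ξ‖ := by
      intro ξ
      by_cases h : ξ ∈ slab n <;> simp [hg, h]
    have hg2 : MemLp g 2 muBar := by
      rw [hg, memLp_indicator_iff_restrict (measurableSet_slab n)]
      have : IsFiniteMeasure (muBar.restrict (slab n)) :=
        ⟨by rw [Measure.restrict_apply_univ]; exact muBar_slab_lt_top n⟩
      refine MemLp.of_bound (Complex.continuous_conj.comp hc).aestronglyMeasurable
        (∫ z, ‖φ z‖) (Eventually.of_forall fun ξ => ?_)
      rw [RCLike.norm_conj]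
      refine (norm_integral_le_integral_norm _).trans_eq ?_
      simp
    have hgi : Integrable g muBar := by
      refine integrable_of_support_subset_slab hg2 (r := n) fun ξ hξ => ?_
      by_contra h
      exact hξ (Set.indicator_of_notMem (by exact h) _)
    have hnorm : eLpNorm ((slab n).indicator (testHat φ)) 2 muBar = eLpNorm g 2 muBar :=
      (eLpNorm_congr_norm_ae (Eventually.of_forall hgn)).symm
    have hsq : eLpNorm g 2 muBar ^ 2 ≤ M * eLpNorm g 2 muBar := by
      have hpt : ∀ ξ, g ξ * testHat φ ξ = ((‖g ξ‖ ^ 2 : ℝ) : ℂ) := by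
        intro ξ
        by_cases h : ξ ∈ slab n
        · simp only [hg, Set.indicator_of_mem h, RCLike.norm_conj]
          rw [Complex.conj_mul']
          push_cast; rfl
        · simp [hg, h]
      have h1 : eLpNorm g 2 muBar ^ 2 = ‖∫ ξ, g ξ * testHat φ ξ ∂muBar‖ₑ := by
        simp_rw [hpt]
        rw [integral_complex_ofReal, ← ofReal_norm, Complex.norm_real,
          Real.norm_of_nonneg (integral_nonneg fun ξ => by positivity),
          ofReal_integral_eq_lintegral_ofReal ((memLp_two_iff_integrable_sq_norm hg2.1).1 hg2)
            (Eventually.of_forall fun ξ => by positivity), eLpNorm_two_sq]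
        refine lintegral_congr fun ξ => ?_
        rw [ENNReal.ofReal_pow (norm_nonneg _), ofReal_norm]
      have h2 : ∫ ξ, g ξ * testHat φ ξ ∂muBar = ∫ z, integralExt g z * φ z :=
        (isExtension_integralExt hgi φ).symm
      rw [h1, h2]
      refine (enorm_integral_mul_le (p := 4) (q := ENNReal.ofReal (4 / 3))
        (memLp_integralExt hgi hg2).1 (SchwartzMap.memLp φ 1 volume).1).trans ?_
      refine (mul_le_mul' (eLpNorm_integralExt_le hgi) le_rfl).trans_eq ?_
      rw [hM]; ring
    rw [hnorm]
    by_cases h0 : eLpNorm g 2 muBar = 0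
    · rw [h0]; exact bot_le
    · rw [sq] at hsq
      -- Dividing by `‖g‖` is legitimate because the truncation makes it finite.
      exact (ENNReal.mul_le_mul_iff_left h0 hg2.2.ne).1 hsq
  have hlim : Tendsto (fun n : ℕ => ∫⁻ ξ, ‖(slab n).indicator (testHat φ) ξ‖ₑ ^ 2 ∂muBar) atTop
      (𝓝 (∫⁻ ξ, ‖testHat φ ξ‖ₑ ^ 2 ∂muBar)) := by
    refine lintegral_tendsto_of_tendsto_of_monotone
      (fun n => ((hc.measurable.indicator (measurableSet_slab n)).enorm.pow_const 2).aemeasurable)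
      (Eventually.of_forall fun ξ m n hmn => ?_) (Eventually.of_forall fun ξ => ?_)
    · refine pow_le_pow_left' ?_ 2
      by_cases h : ξ ∈ slab m
      · have h' : ξ ∈ slab n := le_trans (show ‖ξ.1‖ ≤ m from h) (by exact_mod_cast hmn)
        simp [h, h']
      · simp [h]
    · refine tendsto_const_nhds.congr' ?_
      filter_upwards [eventually_mem_slab ξ] with n h
      simp [h]
  have hle : eLpNorm (testHat φ) 2 muBar ^ 2 ≤ M ^ 2 := by
    rw [eLpNorm_two_sq]
    refine le_of_tendsto hlim (Eventually.of_forall fun n => ?_)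
    rw [← eLpNorm_two_sq]
    exact pow_le_pow_left' (hbd n) 2
  exact ((ENNReal.pow_le_pow_left_iff (by norm_num)).1 hle).trans_lt hMtop

theorem IsExtension.ae_eq {f u v : SpaceTime → ℂ} (hu : IsExtension f u) (hv : IsExtension f v)
    (hu4 : MemLp u 4 volume) (hv4 : MemLp v 4 volume) : u =ᵐ[volume] v := by
  refine ae_eq_of_integral_contDiff_smul_eq (hu4.locallyIntegrable (by norm_num))
    (hv4.locallyIntegrable (by norm_num)) fun g hg hgs => ?_
  have hs : HasCompactSupport fun z => (g z : ℂ) := hgs.comp_left Complex.ofReal_zero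
  have hd : ContDiff ℝ (⊤ : ℕ∞) fun z => (g z : ℂ) := Complex.ofRealCLM.contDiff.comp hg
  have h := (hu (hs.toSchwartzMap hd)).trans (hv (hs.toSchwartzMap hd)).symm
  simpa [mul_comm] using h

/-- By uniqueness all admissible `u` agree almost everywhere, so the infimum is over a single value.
-/
theorem extensionNorm_eq {f u : SpaceTime → ℂ} (hu : IsExtension f u) (hu4 : MemLp u 4 volume) :
    extensionNorm f = eLpNorm u 4 volume := by
  refine le_antisymm (iInf_le_of_le u (iInf_le_of_le hu4 (iInf_le _ hu))) ?_
  exact le_iInf fun v => le_iInf fun hv4 => le_iInf fun hv =>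
    (eLpNorm_congr_ae (hu.ae_eq hv hu4 hv4)).le

/-- Every function in `L²` of the hyperboloid has an extension in `L⁴`. -/
theorem exists_isExtension {f : SpaceTime → ℂ} (hf : MemLp f 2 muBar) :
    ∃ u, MemLp u 4 volume ∧ IsExtension f u ∧
      eLpNorm u 4 volume ≤ (extConst + 1) * eLpNorm f 2 muBar := by
  set F : ℕ → SpaceTime → ℂ := fun n => (slab n).indicator f with hF
  have hFi : ∀ n, Integrable (F n) muBar := fun n => integrable_indicator_slab hf n
  have hF2 : ∀ n, MemLp (F n) 2 muBar := fun n => hf.indicator (measurableSet_slab n)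
  have hlim : Tendsto (fun n => eLpNorm (F n - f) 2 muBar) atTop (𝓝 0) :=
    tendsto_eLpNorm_indicator_slab hf
  have hU4 : ∀ n, MemLp (integralExt (F n)) 4 volume := fun n => memLp_integralExt (hFi n) (hF2 n)
  have : Fact ((1 : ℝ≥0∞) ≤ 4) := ⟨by norm_num⟩
  have hcF : CauchySeq fun n => (hF2 n).toLp (F n) :=
    ((Lp.tendsto_Lp_iff_tendsto_eLpNorm'' F hF2 f hf).2 hlim).cauchySeq
  -- Linearity and the a priori bound make the truncated extensions Cauchy in `L⁴`; their limit is
  -- the desired extension.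
  have hdist : ∀ m n, edist ((hU4 m).toLp (integralExt (F m))) ((hU4 n).toLp (integralExt (F n))) ≤
      (extConst + 1) * edist ((hF2 m).toLp (F m)) ((hF2 n).toLp (F n)) := by
    intro m n
    rw [Lp.edist_toLp_toLp, Lp.edist_toLp_toLp]
    have : integralExt (F m) - integralExt (F n) = integralExt (F m - F n) := by
      ext z
      simp only [integralExt, Pi.sub_apply, mul_sub]
      exact (integral_sub (integrable_character_mul measurable_id (hFi m) z)
        (integrable_character_mul measurable_id (hFi n) z)).symm
    rw [this]
    exact eLpNorm_integralExt_le ((hFi m).sub (hFi n))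
  have hcU : CauchySeq fun n => (hU4 n).toLp (integralExt (F n)) := by
    rw [EMetric.cauchySeq_iff] at hcF ⊢
    intro ε hε
    obtain ⟨N, hN⟩ := hcF (ε / (extConst + 1))
      (ENNReal.div_pos hε.ne' extConst_add_one_ne_top)
    refine ⟨N, fun m hm n hn => (hdist m n).trans_lt ?_⟩
    rw [mul_comm]
    exact (ENNReal.lt_div_iff_mul_lt (Or.inl (by simp)) (Or.inl extConst_add_one_ne_top)).1
      (hN m hm n hn)
  obtain ⟨U, hU⟩ := cauchySeq_tendsto_of_complete hcU
  have hUm : MemLp (U : SpaceTime → ℂ) 4 volume := Lp.memLp U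
  have hUlim : Tendsto (fun n => eLpNorm (integralExt (F n) - (U : SpaceTime → ℂ)) 4 volume)
      atTop (𝓝 0) := by
    rw [← Lp.tendsto_Lp_iff_tendsto_eLpNorm'' (fun n => integralExt (F n)) hU4
      (U : SpaceTime → ℂ) hUm,
      Lp.toLp_coeFn]
    exact hU
  refine ⟨(U : SpaceTime → ℂ), hUm, fun φ => ?_, ?_⟩
  · have h1 := tendsto_integral_mul (q := ENNReal.ofReal (4 / 3)) hU4 hUm
      (SchwartzMap.memLp φ _ volume) hUlim
    have h2 := tendsto_integral_mul hF2 hf (memLp_testHat φ) hlim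
    refine tendsto_nhds_unique h1 (h2.congr fun n => ?_)
    exact (isExtension_integralExt (hFi n) φ).symm
  · have h1 : Tendsto (fun n => eLpNorm (integralExt (F n) - (U : SpaceTime → ℂ)) 4 volume +
        (extConst + 1) * eLpNorm f 2 muBar) atTop (𝓝 (0 + (extConst + 1) * eLpNorm f 2 muBar)) :=
      hUlim.add tendsto_const_nhds
    rw [zero_add] at h1
    refine ge_of_tendsto h1 (Eventually.of_forall fun n => ?_)
    have h2 : (U : SpaceTime → ℂ) = ((U : SpaceTime → ℂ) - integralExt (F n)) + integralExt (F n) := by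
      simp
    conv_lhs => rw [h2]
    refine (eLpNorm_add_le (hUm.1.sub (hU4 n).1) (hU4 n).1 (by norm_num)).trans ?_
    rw [eLpNorm_sub_comm]
    refine add_le_add le_rfl ((eLpNorm_integralExt_le (hFi n)).trans (mul_le_mul' le_rfl ?_))
    exact eLpNorm_indicator_le f

theorem extensionNorm_le {f : SpaceTime → ℂ} (hf : MemLp f 2 muBar) :
    extensionNorm f ≤ (extConst + 1) * eLpNorm f 2 muBar := by
  obtain ⟨u, hu4, hu, hle⟩ := exists_isExtension hf
  rw [extensionNorm_eq hu hu4]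
  exact hle

theorem IsExtension.add {f g u v : SpaceTime → ℂ} (hf : MemLp f 2 muBar) (hg : MemLp g 2 muBar)
    (hu4 : MemLp u 4 volume) (hv4 : MemLp v 4 volume) (hu : IsExtension f u)
    (hv : IsExtension g v) : IsExtension (f + g) (u + v) := by
  intro φ
  have hφ : MemLp φ (ENNReal.ofReal (4 / 3)) volume := SchwartzMap.memLp φ _ volume
  have h1 : Integrable (fun z => u z * φ z) := hu4.integrable_mul hφ
  have h2 : Integrable (fun z => v z * φ z) := hv4.integrable_mul hφ
  have h3 : Integrable (fun ξ => f ξ * testHat φ ξ) muBar := hf.integrable_mul (memLp_testHat φ)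
  have h4 : Integrable (fun ξ => g ξ * testHat φ ξ) muBar := hg.integrable_mul (memLp_testHat φ)
  have hu' := hu φ
  have hv' := hv φ
  simp only [Pi.add_apply, add_mul]
  rw [integral_add h1 h2, hu', hv']
  exact (integral_add h3 h4).symm

theorem IsExtension.congr {f g u : SpaceTime → ℂ} (hu : IsExtension f u) (h : f =ᵐ[muBar] g) :
    IsExtension g u := by
  intro φ
  rw [hu φ]
  refine integral_congr_ae ?_
  filter_upwards [h] with ξ hξ
  rw [hξ]

theorem extensionNorm_add_le {f g u : SpaceTime → ℂ} (hf : MemLp f 2 muBar)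
    (hg : MemLp g 2 muBar) (hu4 : MemLp u 4 volume) (hu : IsExtension f u) :
    extensionNorm (f + g) ≤ eLpNorm u 4 volume + (extConst + 1) * eLpNorm g 2 muBar := by
  obtain ⟨v, hv4, hv, hle⟩ := exists_isExtension hg
  rw [extensionNorm_eq (hu.add hf hg hu4 hv4 hv) (hu4.add hv4)]
  exact (eLpNorm_add_le hu4.1 hv4.1 (by norm_num)).trans (add_le_add le_rfl hle)

/-! ### Finiteness and positivity of the best constant -/

theorem bestConstant_ne_top : bestConstant ≠ ∞ := by
  refine ne_top_of_le_ne_top extConst_add_one_ne_top ?_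
  refine iSup_le fun f => iSup_le fun hf => iSup_le fun _ => ?_
  exact ENNReal.div_le_of_le_mul (extensionNorm_le hf)

theorem extensionNorm_le_bestConstant {f : SpaceTime → ℂ} (hf : MemLp f 2 muBar) :
    extensionNorm f ≤ bestConstant * eLpNorm f 2 muBar := by
  by_cases h0 : f =ᵐ[muBar] 0
  · have h1 : eLpNorm f 2 muBar = 0 := by rw [eLpNorm_congr_ae h0]; simp
    simpa [h1] using extensionNorm_le hf
  · have h1 : extensionNorm f / eLpNorm f 2 muBar ≤ bestConstant :=
      le_iSup_of_le f (le_iSup_of_le hf (le_iSup_of_le h0 le_rfl))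
    refine (ENNReal.div_le_iff_le_mul (Or.inl ?_) (Or.inl hf.2.ne)).1 h1
    rwa [Ne, eLpNorm_eq_zero_iff hf.1 (by norm_num)]

theorem weight_closedBall_pos : 0 < weight {y | ‖y‖ ≤ 2} := by
  have hs : MeasurableSet {y : Space | ‖y‖ ≤ 2} := measurableSet_le measurable_norm measurable_const
  rw [pos_iff_ne_zero]
  intro h0
  have hm : Measurable fun y => ENNReal.ofReal (height y)⁻¹ := measurable_height.inv.ennreal_ofReal
  rw [weight_eq_withDensity, withDensity_apply _ hs, lintegral_eq_zero_iff hm, EventuallyEq,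
    ae_restrict_iff' hs] at h0
  have hopen : IsOpen {y : Space | 1 < ‖y‖ ∧ ‖y‖ < 2} :=
    (isOpen_lt continuous_const continuous_norm).inter (isOpen_lt continuous_norm continuous_const)
  have hne : {y : Space | 1 < ‖y‖ ∧ ‖y‖ < 2}.Nonempty :=
    ⟨EuclideanSpace.single 0 (3 / 2), by norm_num, by norm_num⟩
  have hpos := hopen.measure_pos volume hne
  refine hpos.ne' (measure_mono_null (fun y hy => ?_) (ae_iff.1 h0))
  obtain ⟨h1, h2⟩ := hy
  have hh : 0 < height y := Real.sqrt_pos.2 (by nlinarith)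
  simp only [Set.mem_ofPred_eq, Pi.zero_apply, ENNReal.ofReal_eq_zero, not_forall, not_le]
  exact ⟨h2.le, by positivity⟩

/-- The extension of the indicator of a slab is continuous, and its value at the origin is the
positive mass of the slab; it cannot vanish almost everywhere. -/
theorem bestConstant_ne_zero : bestConstant ≠ 0 := by
  intro h0
  set f : SpaceTime → ℂ := (slab 2).indicator 1 with hf
  have hf2 : MemLp f 2 muBar :=
    memLp_indicator_const 2 (measurableSet_slab 2) (1 : ℂ) (Or.inr (muBar_slab_lt_top 2).ne)
  have hfi : Integrable f muBar := by
    refine integrable_of_support_subset_slab hf2 (r := 2) fun ξ hξ => ?_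
    by_contra h
    exact hξ (Set.indicator_of_notMem (by exact h) _)
  have h1 := extensionNorm_le_bestConstant hf2
  have h4 := memLp_integralExt hfi hf2
  rw [h0, zero_mul, extensionNorm_eq (isExtension_integralExt hfi) h4, nonpos_iff_eq_zero,
    eLpNorm_eq_zero_iff h4.1 (by norm_num),
    Continuous.ae_eq_iff_eq volume (continuous_integralExt hfi) continuous_zero] at h1
  have h2 := congrFun h1 0
  have h3 : integralExt f 0 = (muBar.real (slab 2) : ℂ) := by
    unfold integralExt
    have : ∀ ξ, character 0 ξ * f ξ = f ξ := fun ξ => by simp [character]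
    simp_rw [this]
    rw [hf, integral_indicator (measurableSet_slab 2)]
    simp
  rw [h3] at h2
  simp only [Pi.zero_apply, Complex.ofReal_eq_zero, Measure.real, ENNReal.toReal_eq_zero_iff,
    (muBar_slab_lt_top 2).ne, or_false] at h2
  rw [muBar_slab] at h2
  have := weight_closedBall_pos
  simp [this.ne'] at h2

/-! ### Passing from absolute values to the functions -/

/-- The unimodular phase of a complex number. -/
noncomputable def phase (w : ℂ) : ℂ := if w = 0 then 1 else w / (‖w‖ : ℂ)

theorem measurable_phase : Measurable phase :=
  Measurable.ite (measurableSet_singleton 0) measurable_const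
    (measurable_id.div (Complex.measurable_ofReal.comp measurable_norm))

theorem norm_phase (w : ℂ) : ‖phase w‖ = 1 := by
  unfold phase
  split_ifs with h
  · simp
  · have : ‖w‖ ≠ 0 := norm_ne_zero_iff.2 h
    simp [this]

theorem phase_mul_norm (w : ℂ) : phase w * (‖w‖ : ℂ) = w := by
  unfold phase
  split_ifs with h
  · simp [h]
  · have : (‖w‖ : ℂ) ≠ 0 := by simpa using h
    field_simp

/-- Dichotomy of the absolute values implies dichotomy. -/
theorem Dichotomy.of_norm {lam : ℝ} {ρ : ℕ → SpaceTime → ℂ}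
    (hρ : ∀ k, AEStronglyMeasurable (ρ k) muBar)
    (h : Dichotomy lam fun k ξ => ((‖ρ k ξ‖ : ℝ) : ℂ)) : Dichotomy lam ρ := by
  obtain ⟨α, hα, h⟩ := h
  refine ⟨α, hα, fun ε hε => ?_⟩
  obtain ⟨R, k₀, ρ₁, ρ₂, ℓ, R', hR', h⟩ := h ε hε
  have hmem : ∀ k (g : SpaceTime → ℂ), MemLp g 2 muBar →
      MemLp (fun ξ => phase (ρ k ξ) * g ξ) 2 muBar := by
    intro k g hg
    refine hg.of_le ?_ (Eventually.of_forall fun ξ => by simp [norm_phase])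
    exact (measurable_phase.comp_aemeasurable (hρ k).aemeasurable).aestronglyMeasurable.mul hg.1
  -- A factor that is unimodular everywhere, zeros of `ρ k` included, preserves masses, supports and
  -- the approximation error.
  refine ⟨R, k₀, fun k ξ => phase (ρ k ξ) * ρ₁ k ξ, fun k ξ => phase (ρ k ξ) * ρ₂ k ξ, ℓ, R', hR',
    fun k hk => ?_⟩
  obtain ⟨h1, h2, h3, h4, h5, h6, h7⟩ := h k hk
  refine ⟨hmem k _ h1, hmem k _ h2, ?_, ?_, ?_, ?_, ?_⟩
  · refine le_trans (le_of_eq ?_) h3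
    refine eLpNorm_congr_norm_ae (Eventually.of_forall fun ξ => ?_)
    have : ρ k ξ - (phase (ρ k ξ) * ρ₁ k ξ + phase (ρ k ξ) * ρ₂ k ξ) =
        phase (ρ k ξ) * (((‖ρ k ξ‖ : ℝ) : ℂ) - (ρ₁ k ξ + ρ₂ k ξ)) := by
      rw [mul_sub, phase_mul_norm]; ring
    rw [this, norm_mul, norm_phase, one_mul]
  · simpa [norm_phase] using h4
  · simpa [norm_phase] using h5
  · filter_upwards [h6] with ξ hξ hne using hξ (right_ne_zero_of_mul hne)
  · filter_upwards [h7] with ξ hξ hne using hξ (right_ne_zero_of_mul hne)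

/-! ### Weak interaction of separated scales -/

/-- Completing a square absorbs the cubic cross terms `4ab(a² + b²)` into a small multiple of `a⁴ +
b⁴` and a large multiple of `(ab)²`, which only the bilinear estimate has to control. -/
theorem add_pow_four_le {a b δ : ℝ} (hδ : 0 < δ) :
    (a + b) ^ 4 ≤ (1 + δ) * (a ^ 4 + b ^ 4) + (6 + 2 * δ + 4 / δ) * (a * b) ^ 2 := by
  have h : (1 + δ) * (a ^ 4 + b ^ 4) + (6 + 2 * δ + 4 / δ) * (a * b) ^ 2 - (a + b) ^ 4 =
      δ * (a ^ 2 + b ^ 2 - 2 / δ * (a * b)) ^ 2 := by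
    field_simp
    ring
  have : 0 ≤ δ * (a ^ 2 + b ^ 2 - 2 / δ * (a * b)) ^ 2 := by positivity
  linarith

theorem enorm_add_pow_four_le (a b : ℂ) {δ : ℝ} (hδ : 0 < δ) :
    ‖a + b‖ₑ ^ 4 ≤ ENNReal.ofReal (1 + δ) * (‖a‖ₑ ^ 4 + ‖b‖ₑ ^ 4) +
      ENNReal.ofReal (6 + 2 * δ + 4 / δ) * ‖a * b‖ₑ ^ 2 := by
  have h : ‖a + b‖ ^ 4 ≤ (1 + δ) * (‖a‖ ^ 4 + ‖b‖ ^ 4) +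
      (6 + 2 * δ + 4 / δ) * ‖a * b‖ ^ 2 := by
    rw [norm_mul]
    exact (pow_le_pow_left₀ (norm_nonneg _) (norm_add_le a b) 4).trans (add_pow_four_le hδ)
  simp only [← ofReal_norm]
  rw [← ENNReal.ofReal_pow (norm_nonneg _), ← ENNReal.ofReal_pow (norm_nonneg _),
    ← ENNReal.ofReal_pow (norm_nonneg _), ← ENNReal.ofReal_pow (norm_nonneg _),
    ← ENNReal.ofReal_add (by positivity) (by positivity), ← ENNReal.ofReal_mul (by positivity),
    ← ENNReal.ofReal_mul (by positivity), ← ENNReal.ofReal_add (by positivity) (by positivity)]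
  exact ENNReal.ofReal_le_ofReal h

/-- By the reverse triangle inequality `‖x + y‖` is at least the larger norm minus the smaller,
hence at least `c - 1` times the smaller. -/
theorem min_le_of_separated {F : Type*} [NormedAddCommGroup F] {x y : F} {c : ℝ} (hc : 1 < c)
    (h : c * ‖y‖ ≤ ‖x‖ ∨ c * ‖x‖ ≤ ‖y‖) : min ‖x‖ ‖y‖ ≤ 1 / (c - 1) * ‖x + y‖ := by
  have h1 : ‖x‖ - ‖y‖ ≤ ‖x + y‖ := by simpa using norm_sub_norm_le x (-y)
  have h2 : ‖y‖ - ‖x‖ ≤ ‖x + y‖ := by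
    have := norm_sub_norm_le y (-x)
    rw [norm_neg, sub_neg_eq_add, add_comm y x] at this
    exact this
  rw [one_div, inv_mul_eq_div, le_div_iff₀ (by linarith)]
  rcases h with h | h
  · nlinarith [mul_le_mul_of_nonneg_right (min_le_right ‖x‖ ‖y‖) (by linarith : 0 ≤ c - 1)]
  · nlinarith [mul_le_mul_of_nonneg_right (min_le_left ‖x‖ ‖y‖) (by linarith : 0 ≤ c - 1)]

/-- The interaction of two pieces of the hyperboloid at separated scales is small. -/
theorem lintegral_integralExt_mul_le_of_separated {f g : SpaceTime → ℂ} (hf : Integrable f muBar)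
    (hg : Integrable g muBar) {c : ℝ} (hc : 1 < c)
    (hfg : ∀ ξ η, f ξ ≠ 0 → g η ≠ 0 → c * ‖η.1‖ ≤ ‖ξ.1‖ ∨ c * ‖ξ.1‖ ≤ ‖η.1‖) :
    ∫⁻ z, ‖integralExt f z * integralExt g z‖ₑ ^ 2 ≤
      4 * ENNReal.ofReal (64 * Real.pi ^ 5 * (1 / (c - 1))) *
        ((∫⁻ ξ, ‖f ξ‖ₑ ^ 2 ∂muBar) * ∫⁻ ξ, ‖g ξ‖ₑ ^ 2 ∂muBar) := by
  have hc' : 0 ≤ 1 / (c - 1) := one_div_nonneg.2 (by linarith)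
  refine lintegral_integralExt_mul_le hf hg hc' fun ξ η hξ hη => ⟨?_, ?_⟩
  · exact min_le_of_separated hc (hfg ξ η hξ hη)
  · have h := min_le_of_separated (x := ξ.1) (y := -η.1) hc
      (by simpa only [norm_neg] using hfg ξ η hξ hη)
    simpa only [norm_neg, ← sub_eq_add_neg] using h

/-- The extension of the sum of two functions at separated scales: the fourth powers of the norms
nearly add up. -/
theorem eLpNorm_integralExt_add_pow_le {f g : SpaceTime → ℂ} (hf : Integrable f muBar)
    (hg : Integrable g muBar) (hf2 : MemLp f 2 muBar) (hg2 : MemLp g 2 muBar) {c : ℝ} (hc : 1 < c)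
    (hfg : ∀ ξ η, f ξ ≠ 0 → g η ≠ 0 → c * ‖η.1‖ ≤ ‖ξ.1‖ ∨ c * ‖ξ.1‖ ≤ ‖η.1‖) {δ a b h : ℝ}
    (hδ : 0 < δ) (ha0 : 0 ≤ a) (hb0 : 0 ≤ b) (hh0 : 0 ≤ h)
    (hh : bestConstant = ENNReal.ofReal h)
    (ha : ∫⁻ ξ, ‖f ξ‖ₑ ^ 2 ∂muBar ≤ ENNReal.ofReal a)
    (hb : ∫⁻ ξ, ‖g ξ‖ₑ ^ 2 ∂muBar ≤ ENNReal.ofReal b) :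
    eLpNorm (integralExt f + integralExt g) 4 volume ^ 4 ≤
      ENNReal.ofReal ((1 + δ) * (h ^ 4 * (a ^ 2 + b ^ 2)) +
        (6 + 2 * δ + 4 / δ) * (4 * (64 * Real.pi ^ 5 * (1 / (c - 1))) * (a * b))) := by
  have hc' : 0 ≤ 1 / (c - 1) := one_div_nonneg.2 (by linarith)
  -- The fourth power of the `L²` norm is the square of the mass; this is the source of `a² + b²`.
  have hself : ∀ {u : SpaceTime → ℂ} {m : ℝ}, Integrable u muBar → MemLp u 2 muBar → 0 ≤ m →
      ∫⁻ ξ, ‖u ξ‖ₑ ^ 2 ∂muBar ≤ ENNReal.ofReal m →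
      ∫⁻ z, ‖integralExt u z‖ₑ ^ 4 ≤ ENNReal.ofReal (h ^ 4 * m ^ 2) := by
    intro u m hu hu2 hm hle
    have h1 := extensionNorm_le_bestConstant hu2
    rw [extensionNorm_eq (isExtension_integralExt hu) (memLp_integralExt hu hu2), hh] at h1
    rw [← eLpNorm_four_pow]
    refine (pow_le_pow_left' h1 4).trans ?_
    rw [mul_pow, show 4 = 2 * 2 from rfl, pow_mul (eLpNorm u 2 muBar), eLpNorm_two_sq,
      ENNReal.ofReal_mul (by positivity), ENNReal.ofReal_pow hh0, ENNReal.ofReal_pow hm]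
    exact mul_le_mul' le_rfl (pow_le_pow_left' hle 2)
  have hcont := continuous_integralExt hf
  have hcont' := continuous_integralExt hg
  rw [eLpNorm_four_pow]
  calc ∫⁻ z, ‖(integralExt f + integralExt g) z‖ₑ ^ 4
      ≤ ∫⁻ z, (ENNReal.ofReal (1 + δ) * (‖integralExt f z‖ₑ ^ 4 + ‖integralExt g z‖ₑ ^ 4) +
          ENNReal.ofReal (6 + 2 * δ + 4 / δ) * ‖integralExt f z * integralExt g z‖ₑ ^ 2) :=
        lintegral_mono fun z => enorm_add_pow_four_le _ _ hδ
    _ = ENNReal.ofReal (1 + δ) * ((∫⁻ z, ‖integralExt f z‖ₑ ^ 4) +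
          ∫⁻ z, ‖integralExt g z‖ₑ ^ 4) + ENNReal.ofReal (6 + 2 * δ + 4 / δ) *
            ∫⁻ z, ‖integralExt f z * integralExt g z‖ₑ ^ 2 := by
        have hmf : Measurable fun z => ‖integralExt f z‖ₑ ^ 4 := hcont.measurable.enorm.pow_const 4
        have hmg : Measurable fun z => ‖integralExt g z‖ₑ ^ 4 := hcont'.measurable.enorm.pow_const 4
        have hmfg : Measurable fun z => ENNReal.ofReal (1 + δ) *
            (‖integralExt f z‖ₑ ^ 4 + ‖integralExt g z‖ₑ ^ 4) := by fun_prop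
        rw [lintegral_add_left hmfg,
          lintegral_const_mul' _ _ ENNReal.ofReal_ne_top,
          lintegral_const_mul' _ _ ENNReal.ofReal_ne_top, lintegral_add_left hmf]
    _ ≤ ENNReal.ofReal (1 + δ) * (ENNReal.ofReal (h ^ 4 * a ^ 2) +
          ENNReal.ofReal (h ^ 4 * b ^ 2)) + ENNReal.ofReal (6 + 2 * δ + 4 / δ) *
            (4 * ENNReal.ofReal (64 * Real.pi ^ 5 * (1 / (c - 1))) *
              (ENNReal.ofReal a * ENNReal.ofReal b)) := by
        refine add_le_add (mul_le_mul' le_rfl (add_le_add (hself hf hf2 ha0 ha)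
          (hself hg hg2 hb0 hb))) (mul_le_mul' le_rfl ?_)
        exact (lintegral_integralExt_mul_le_of_separated hf hg hc hfg).trans
          (mul_le_mul' le_rfl (mul_le_mul' ha hb))
    _ = _ := by
        rw [show (4 : ℝ≥0∞) = ENNReal.ofReal 4 by simp,
          ← ENNReal.ofReal_add (by positivity) (by positivity),
          ← ENNReal.ofReal_mul (by positivity),
          ← ENNReal.ofReal_mul (by positivity), ← ENNReal.ofReal_mul (by positivity),
          ← ENNReal.ofReal_mul (by positivity), ← ENNReal.ofReal_mul (by positivity),
          ← ENNReal.ofReal_add (by positivity) (by positivity)]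
        congr 1
        ring

theorem lintegral_sq_enorm_le {g : SpaceTime → ℂ} (hg : MemLp g 2 muBar) {a ε : ℝ}
    (h : |(∫ ξ, ‖g ξ‖ ^ 2 ∂muBar) - a| ≤ ε) :
    ∫⁻ ξ, ‖g ξ‖ₑ ^ 2 ∂muBar ≤ ENNReal.ofReal (a + ε) := by
  have h1 : ∫⁻ ξ, ‖g ξ‖ₑ ^ 2 ∂muBar = ENNReal.ofReal (∫ ξ, ‖g ξ‖ ^ 2 ∂muBar) := by
    rw [ofReal_integral_eq_lintegral_ofReal ((memLp_two_iff_integrable_sq_norm hg.1).1 hg)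
      (Eventually.of_forall fun ξ => by positivity)]
    refine lintegral_congr fun ξ => ?_
    rw [ENNReal.ofReal_pow (norm_nonneg _), ofReal_norm]
  rw [h1]
  exact ENNReal.ofReal_le_ofReal (by linarith [(abs_le.1 h).2])

theorem scales_separated {ℓ R R' x y : ℝ}
    (hx : (2 : ℝ) ^ (ℓ - R) ≤ x ∧ x ≤ (2 : ℝ) ^ (ℓ + R))
    (hy : y ≤ (2 : ℝ) ^ (ℓ - R') ∨ (2 : ℝ) ^ (ℓ + R') ≤ y) :
    (2 : ℝ) ^ (R' - R) * y ≤ x ∨ (2 : ℝ) ^ (R' - R) * x ≤ y := by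
  have hpos : (0 : ℝ) < 2 ^ (R' - R) := by positivity
  rcases hy with hy | hy
  · left
    refine (mul_le_mul_of_nonneg_left hy hpos.le).trans (le_trans (le_of_eq ?_) hx.1)
    rw [← Real.rpow_add two_pos]; congr 1; ring
  · right
    refine (mul_le_mul_of_nonneg_left hx.2 hpos.le).trans (le_trans (le_of_eq ?_) hy)
    rw [← Real.rpow_add two_pos]; congr 1; ring

/-- The bound for the extension of a function close to a sum of two pieces at separated scales. -/
theorem extensionNorm_le_of_dichotomy {ρ ρ₁ ρ₂ : SpaceTime → ℂ} (hρ : MemLp ρ 2 muBar)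
    (hρ₁ : MemLp ρ₁ 2 muBar) (hρ₂ : MemLp ρ₂ 2 muBar) {ε a b ℓ R R' h : ℝ} (hε : 0 < ε)
    (ha : 0 ≤ a) (hb : 0 ≤ b) (hR : R < R') (hh0 : 0 ≤ h)
    (hh : bestConstant = ENNReal.ofReal h)
    (hclose : eLpNorm (fun ξ => ρ ξ - (ρ₁ ξ + ρ₂ ξ)) 2 muBar ≤ ENNReal.ofReal ε)
    (h₁ : |(∫ ξ, ‖ρ₁ ξ‖ ^ 2 ∂muBar) - a| ≤ ε) (h₂ : |(∫ ξ, ‖ρ₂ ξ‖ ^ 2 ∂muBar) - b| ≤ ε)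
    (hs₁ : ∀ᵐ ξ ∂muBar, ρ₁ ξ ≠ 0 → (2 : ℝ) ^ (ℓ - R) ≤ ‖ξ.1‖ ∧ ‖ξ.1‖ ≤ (2 : ℝ) ^ (ℓ + R))
    (hs₂ : ∀ᵐ ξ ∂muBar, ρ₂ ξ ≠ 0 → ‖ξ.1‖ ≤ (2 : ℝ) ^ (ℓ - R') ∨ (2 : ℝ) ^ (ℓ + R') ≤ ‖ξ.1‖) :
    ∃ y : ℝ≥0∞, y ^ 4 ≤ ENNReal.ofReal ((1 + ε) * (h ^ 4 * ((a + ε) ^ 2 + (b + ε) ^ 2)) +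
        (6 + 2 * ε + 4 / ε) * (4 * (64 * Real.pi ^ 5 * (1 / ((2 : ℝ) ^ (R' - R) - 1))) *
          ((a + ε) * (b + ε)))) ∧
      extensionNorm ρ ≤ y + (extConst + 1) * ENNReal.ofReal (2 * ε) := by
  set S₁ : Set SpaceTime := {ξ | (2 : ℝ) ^ (ℓ - R) ≤ ‖ξ.1‖ ∧ ‖ξ.1‖ ≤ (2 : ℝ) ^ (ℓ + R)} with hS₁
  set S₂ : Set SpaceTime := {ξ | ‖ξ.1‖ ≤ (2 : ℝ) ^ (ℓ - R') ∨ (2 : ℝ) ^ (ℓ + R') ≤ ‖ξ.1‖} with hS₂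
  have hN : Measurable fun ξ : SpaceTime => ‖ξ.1‖ := by fun_prop
  have hS₁m : MeasurableSet S₁ :=
    (measurableSet_le measurable_const hN).inter (measurableSet_le hN measurable_const)
  have hS₂m : MeasurableSet S₂ :=
    (measurableSet_le hN measurable_const).union (measurableSet_le measurable_const hN)
  -- Cutting off by the sets themselves turns the almost-everywhere support conditions into
  -- pointwise ones, as the bilinear estimate requires.
  set g := S₂.indicator ρ₂ with hg
  have hg2 : MemLp g 2 muBar := hρ₂.indicator hS₂m
  have hgρ : g =ᵐ[muBar] ρ₂ := by
    filter_upwards [hs₂] with ξ hξ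
    by_cases h0 : ρ₂ ξ = 0
    · by_cases hm : ξ ∈ S₂ <;> simp [hg, hm, h0]
    · exact Set.indicator_of_mem (s := S₂) (hξ h0) _
  -- The second piece may reach infinity, so it is truncated to become integrable; the extra error
  -- `ε` leads to the `2 * ε` in the conclusion.
  obtain ⟨n, hn⟩ := ((tendsto_eLpNorm_indicator_slab hg2).eventually_lt_const
    (ENNReal.ofReal_pos.2 hε)).exists
  set σ₁ := S₁.indicator ρ₁ with hσ₁
  set σ₂ := (slab n).indicator g with hσ₂
  have hσ₁2 : MemLp σ₁ 2 muBar := hρ₁.indicator hS₁m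
  have hσ₂2 : MemLp σ₂ 2 muBar := hg2.indicator (measurableSet_slab n)
  have hσ₁s : ∀ ξ, σ₁ ξ ≠ 0 → ξ ∈ S₁ := fun ξ hξ => by
    by_contra hm
    exact hξ (Set.indicator_of_notMem hm _)
  have hσ₂s : ∀ ξ, σ₂ ξ ≠ 0 → ξ ∈ S₂ := fun ξ hξ => by
    by_contra hm
    refine hξ ?_
    simp [hσ₂, hg, hm]
  have hσ₁i : Integrable σ₁ muBar :=
    integrable_of_support_subset_slab hσ₁2 (fun ξ hξ => (hσ₁s ξ hξ).2)
  have hσ₂i : Integrable σ₂ muBar := integrable_indicator_slab hg2 n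
  have hσρ : σ₁ =ᵐ[muBar] ρ₁ := by
    filter_upwards [hs₁] with ξ hξ
    by_cases h0 : ρ₁ ξ = 0
    · by_cases hm : ξ ∈ S₁ <;> simp [hσ₁, hm, h0]
    · exact Set.indicator_of_mem (s := S₁) (hξ h0) _
  have hm₁ : ∫⁻ ξ, ‖σ₁ ξ‖ₑ ^ 2 ∂muBar ≤ ENNReal.ofReal (a + ε) := by
    refine (lintegral_mono fun ξ => ?_).trans (lintegral_sq_enorm_le hρ₁ h₁)
    exact pow_le_pow_left' (enorm_indicator_le_enorm_self ρ₁ ξ) 2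
  have hm₂ : ∫⁻ ξ, ‖σ₂ ξ‖ₑ ^ 2 ∂muBar ≤ ENNReal.ofReal (b + ε) := by
    refine (lintegral_mono fun ξ => ?_).trans (lintegral_sq_enorm_le hρ₂ h₂)
    exact pow_le_pow_left' ((enorm_indicator_le_enorm_self g ξ).trans
      (enorm_indicator_le_enorm_self ρ₂ ξ)) 2
  have hc : (1 : ℝ) < 2 ^ (R' - R) := Real.one_lt_rpow one_lt_two (by linarith)
  have hmain := eLpNorm_integralExt_add_pow_le hσ₁i hσ₂i hσ₁2 hσ₂2 hc
    (fun ξ η hξ hη => scales_separated (hσ₁s ξ hξ) (hσ₂s η hη)) hε (add_nonneg ha hε.le)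
    (add_nonneg hb hε.le) hh0 hh hm₁ hm₂
  refine ⟨_, hmain, ?_⟩
  set r : SpaceTime → ℂ := ρ - (σ₁ + σ₂) with hr
  have hr2 : MemLp r 2 muBar := hρ.sub (hσ₁2.add hσ₂2)
  have hrle : eLpNorm r 2 muBar ≤ ENNReal.ofReal (2 * ε) := by
    have h3 : r =ᵐ[muBar] (fun ξ => ρ ξ - (ρ₁ ξ + ρ₂ ξ)) - (σ₂ - g) := by
      filter_upwards [hσρ, hgρ] with ξ e1 e2
      simp only [hr, Pi.sub_apply, Pi.add_apply, e1, e2]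
      ring
    rw [eLpNorm_congr_ae h3, two_mul, ENNReal.ofReal_add hε.le hε.le]
    exact (eLpNorm_sub_le (hρ.1.sub (hρ₁.1.add hρ₂.1)) (hσ₂2.1.sub hg2.1) (by norm_num)).trans
      (add_le_add hclose hn.le)
  have hσ4 := (memLp_integralExt hσ₁i hσ₁2).add (memLp_integralExt hσ₂i hσ₂2)
  have hext := (isExtension_integralExt hσ₁i).add hσ₁2 hσ₂2 (memLp_integralExt hσ₁i hσ₁2)
    (memLp_integralExt hσ₂i hσ₂2) (isExtension_integralExt hσ₂i)
  have hsum : ρ = (σ₁ + σ₂) + r := by simp [hr]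
  rw [hsum]
  exact (extensionNorm_add_le (hσ₁2.add hσ₂2) hr2 hσ4 hext).trans
    (add_le_add le_rfl (mul_le_mul' le_rfl hrle))

/-! ### Exclusion of dichotomy -/

/-- A sequence in `L²` along which the norms of the extensions tend to the best constant does not
satisfy dichotomy. -/
theorem not_dichotomy_of_tendsto {ρ : ℕ → SpaceTime → ℂ} (hρ : ∀ k, MemLp (ρ k) 2 muBar)
    (hlim : Tendsto (fun k => extensionNorm (ρ k)) atTop (𝓝 bestConstant)) :
    ¬ Dichotomy 1 ρ := by
  rintro ⟨α, ⟨hα0, hα1⟩, hdich⟩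
  set h := bestConstant.toReal with hh
  have hH : bestConstant = ENNReal.ofReal h := (ENNReal.ofReal_toReal bestConstant_ne_top).symm
  have hpos : 0 < h := ENNReal.toReal_pos bestConstant_ne_zero bestConstant_ne_top
  set L := (extConst + 1).toReal with hL
  have hL' : extConst + 1 = ENNReal.ofReal L :=
    (ENNReal.ofReal_toReal extConst_add_one_ne_top).symm
  have hL0 : 0 ≤ L := ENNReal.toReal_nonneg
  -- First `k → ∞` with `ε` fixed: the cross term carries `4 / ε`, but its factor `1 / (2 ^ (R' k -
  -- R) - 1)` tends to zero. Only afterwards does `ε → 0`.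
  have key : ∀ ε : ℝ, 0 < ε → 0 ≤ h - L * (2 * ε) →
      (h - L * (2 * ε)) ^ 4 ≤
        (1 + ε) * (h ^ 4 * ((α + ε) ^ 2 + (1 - α + ε) ^ 2)) + ε := by
    intro ε hε hnn
    obtain ⟨R, k₀, ρ₁, ρ₂, ℓ, R', hR', hk⟩ := hdich ε hε
    set X := (1 + ε) * (h ^ 4 * ((α + ε) ^ 2 + (1 - α + ε) ^ 2)) with hX
    have hX0 : 0 ≤ X := by positivity
    set D := (6 + 2 * ε + 4 / ε) * (4 * (64 * Real.pi ^ 5)) * ((α + ε) * (1 - α + ε)) with hD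
    have hsmall : Tendsto (fun k => D * ((2 : ℝ) ^ (R' k - R) - 1)⁻¹) atTop (𝓝 0) := by
      have h1 : Tendsto (fun k => (2 : ℝ) ^ (R' k - R) - 1) atTop atTop := by
        refine tendsto_atTop_add_const_right _ _ ?_
        exact (tendsto_rpow_atTop_of_base_gt_one 2 one_lt_two).comp
          (tendsto_atTop_add_const_right _ _ hR')
      simpa using (tendsto_inv_atTop_zero.comp h1).const_mul D
    have hev : ∀ᶠ k in atTop, extensionNorm (ρ k) ≤
        ENNReal.ofReal ((X + ε) ^ (1 / 4 : ℝ) + L * (2 * ε)) := by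
      filter_upwards [eventually_ge_atTop k₀, hsmall.eventually_lt_const hε,
        hR'.eventually_gt_atTop (R : ℝ)] with k hk0 hDk hRk
      obtain ⟨m1, m2, h3, h4, h5, h6, h7⟩ := hk k hk0
      obtain ⟨y, hy, hle⟩ := extensionNorm_le_of_dichotomy (hρ k) m1 m2 hε hα0.le
        (sub_nonneg.2 hα1.le) hRk hpos.le hH h3 h4 h5 h6 h7
      refine hle.trans ?_
      rw [ENNReal.ofReal_add (by positivity) (by positivity), ENNReal.ofReal_mul hL0, hL']
      refine add_le_add ?_ le_rfl
      refine (ENNReal.pow_le_pow_left_iff (n := 4) (by norm_num)).1 ?_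
      rw [← ENNReal.ofReal_pow (by positivity), ← Real.rpow_natCast,
        ← Real.rpow_mul (by positivity)]
      refine hy.trans (ENNReal.ofReal_le_ofReal ?_)
      norm_num
      have : (6 + 2 * ε + 4 / ε) * (4 * (64 * Real.pi ^ 5 * ((2 : ℝ) ^ (R' k - R) - 1)⁻¹) *
          ((α + ε) * (1 - α + ε))) = D * ((2 : ℝ) ^ (R' k - R) - 1)⁻¹ := by rw [hD]; ring
      rw [this]
      linarith
    have h1 := le_of_tendsto hlim hev
    rw [hH, ENNReal.ofReal_le_ofReal_iff (by positivity)] at h1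
    have h2 : h - L * (2 * ε) ≤ (X + ε) ^ (1 / 4 : ℝ) := by linarith
    refine (pow_le_pow_left₀ hnn h2 4).trans_eq ?_
    rw [← Real.rpow_natCast, ← Real.rpow_mul (by positivity)]
    norm_num
  have hl : Tendsto (fun ε : ℝ => (h - L * (2 * ε)) ^ 4) (𝓝[>] 0) (𝓝 (h ^ 4)) := by
    have hc : Continuous fun ε : ℝ => (h - L * (2 * ε)) ^ 4 := by fun_prop
    simpa using (hc.tendsto 0).mono_left nhdsWithin_le_nhds
  have hr : Tendsto (fun ε : ℝ =>
      (1 + ε) * (h ^ 4 * ((α + ε) ^ 2 + (1 - α + ε) ^ 2)) + ε) (𝓝[>] 0)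
      (𝓝 (h ^ 4 * (α ^ 2 + (1 - α) ^ 2))) := by
    have hc : Continuous fun ε : ℝ =>
      (1 + ε) * (h ^ 4 * ((α + ε) ^ 2 + (1 - α + ε) ^ 2)) + ε := by fun_prop
    simpa using (hc.tendsto 0).mono_left nhdsWithin_le_nhds
  have hnn : ∀ᶠ ε : ℝ in 𝓝[>] 0, 0 ≤ h - L * (2 * ε) := by
    have hc : Continuous fun ε : ℝ => h - L * (2 * ε) := by fun_prop
    have h1 : Tendsto (fun ε : ℝ => h - L * (2 * ε)) (𝓝[>] 0) (𝓝 h) := by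
      simpa using (hc.tendsto 0).mono_left nhdsWithin_le_nhds
    exact (h1.eventually_const_lt hpos).mono fun _ h => h.le
  have hfin : h ^ 4 ≤ h ^ 4 * (α ^ 2 + (1 - α) ^ 2) := by
    refine le_of_tendsto_of_tendsto hl hr ?_
    filter_upwards [hnn, self_mem_nhdsWithin] with ε h1 h2
    exact key ε h2 h1
  -- The left side equals `1 - 2α(1 - α)`, so both strict bounds on `α` are essential.
  have hq : α ^ 2 + (1 - α) ^ 2 < 1 := by nlinarith
  have : 0 < h ^ 4 := by positivity
  nlinarith

end OneSheetedHyperboloid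

theorem mainTheorem9 (f : ℕ → OneSheetedHyperboloid.SpaceTime → ℂ)
    (hf : OneSheetedHyperboloid.IsExtremizingSeq f) (φ : ℕ → ℕ) (hφ : StrictMono φ) :
    ¬ OneSheetedHyperboloid.Dichotomy 1 (fun k => f (φ k)) ∧
    ¬ OneSheetedHyperboloid.Dichotomy 1 (fun k ξ => ((‖f (φ k) ξ‖ : ℝ) : ℂ)) := by
  have h := OneSheetedHyperboloid.not_dichotomy_of_tendsto (fun k => hf.memLp (φ k))
    (hf.tendsto.comp hφ.tendsto_atTop)
  exact ⟨h, fun hd => h (hd.of_norm fun k => (hf.memLp (φ k)).1)⟩
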